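/- **Setting.** Let $d,N\ge 1$, let $\Omega\subset\mathbb R^d$ be open and bounded, and let $\Sigma_0,\dots,\Sigma_{N-1}\subset\mathbb R^d$ be bounded measurable sets (for instance all equal to one bounded open set $\Sigma$). For $j=0,\dots,N-1$ let $a_j:\Sigma_j\times\Omega\to\mathbb R$ be measurable and $(A_jx)(s)=\int_\Omega a_j(s,t)x(t)\,dt$. For nonnegative functions $v,u$ let $d(v,u)=\int[v\ln\frac vu-v+u]\in[0,\infty]$ (with $0\ln\frac0u=0$ and $v\ln\frac v0=\infty$ for $v>0$). Let $x_0\in L^1(\Omega)$ with $x_0\ge0$ and $\int_\Omega x_0=1$. Assume: - (A1) $\int_{\Sigma_j}a_j(s,t)\,ds=1$ for a.e. $t\in\Omega$ and every $j$; - (A2) there are constants $m,M>0$ with $m\le a_j(s,t)\le M$ a.e. in $\Sigma_j\times\Omega$ for every $j$; - (A3) the exact data $y_j\in L^1(\Sigma_j)$ satisfy $\int_{\Sigma_j}y_j=1$, and there is $M'>0$ with $y_j\le M'$ a.e. for every $j$; - (A4) there is $x^*\in L^1(\Omega)$, $x^*\ge0$, not a.e. equal to $0$, with $A_jx^*=y_j$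 for all $j$ and $d(x^*,x_0)<\infty$. Fix $m_1,M_1>0$, $\tau>1$ and $\gamma=\max\{|\ln\frac{m_1}{M}|,|\ln\frac{M_1}{m}|\}$. *Admissible noisy data* with noise level $\delta=(\delta_0,\dots,\delta_{N-1})\in(0,\infty)^N$ are functions $y_j^\delta\in L^1(\Sigma_j)$ with $\|y_j-y_j^\delta\|_{L^1}\le\delta_j$, (A5) $\int_{\Sigma_j}y_j^\delta=1$, and (A6) $m_1\le y_j^\delta\le M_1$ a.e., for every $j$. For such data the loping OS-EM iteration is $x_0^\delta=x_0$ and, with $j=k\bmod N$, $$x_{k+1}^\delta(t)=x_k^\delta(t)\int_{\Sigma_j}\frac{a_j(s,t)\,y_j^\delta(s)}{(A_jx_k^\delta)(s)}\,ds\quad\text{if } d(y_j^\delta,A_jx_k^\delta)>\tau\gamma\delta_j,\qquad x_{k+1}^\delta=x_k^\delta\quad\text{otherwise.}$$ Let $k_*^\delta$ be the smallest multiple $k=rN$ ($r\in\{0,1,2,\dots\}$) of $N$ with $x_k^\delta=x_{k+1}^\delta=\dots=x_{k+N}^\delta$ a.e. in $\Omega$. **Theorem.** (i) For all admissible noisy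 data, $k_*^\delta$ exists (is finite). (ii) $k_*^\delta=O(\delta_{\min}^{-1})$, $\delta_{\min}=\min_j\delta_j$: there is a constant $C$, independent of $\delta$ and of the noisy data, with $k_*^\delta\le C/\delta_{\min}$ for all admissible noisy data. (iii) For all admissible noisy data and all $j$, $d(y_j^\delta,A_jx_{k_*^\delta}^\delta)\le\tau\gamma\delta_j$. (iv) For all $p\in[1,\infty)$ and all $j$, $\|A_jx_{k_*^\delta}^\delta-y_j\|_{L^p(\Sigma_j)}\to0$ as $\delta\to0$, uniformly over admissible noisy data. (v) Let $(\delta^l)_{l\in\mathbb N}\subset(0,\infty)^N$ with $\delta_j^l\to0$ for every $j$, let $(y^l)$ be admissible noisy data with noise levels $\delta^l$, and let $x_{k_*^l}^{\delta^l}$ be the corresponding stopped iterates. If, for some $p\in(1,\infty)$, the sequence $(x_{k_*^l}^{\delta^l})_l$ is bounded in $L^p(\Omega)$, then it has a subsequence which converges weakly in $L^p(\Omega)$ to some $z$ with $A_jz=y_j$ a.e. in $\Sigma_j$ for all $j$. -/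

import Mathlib

open MeasureTheory Filter Topology
open scoped ENNReal

namespace LopingOSEM

/-- Integrand of the Kullback-Leibler distance of nonnegative functions,
`v ln (v / u) - v + u`, with the conventions `0 ln (0 / u) = 0` and `v ln (v / 0) = ∞` for
`v ≠ 0`.  It is nonnegative for `u, v ≥ 0`. -/
noncomputable def klIntegrand (v u : ℝ) : ℝ≥0∞ :=
  if u = 0 ∧ v ≠ 0 then ∞ else ENNReal.ofReal (v * Real.log (v / u) - v + u)

/-- The Kullback-Leibler distance `d(v, u)` of nonnegative functions on `D`. -/
noncomputable def klDist {d : ℕ} (D : Set (EuclideanSpace ℝ (Fin d)))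
    (v u : EuclideanSpace ℝ (Fin d) → ℝ) : ℝ≥0∞ :=
  ∫⁻ t in D, klIntegrand (v t) (u t)

/-- The Fredholm integral operator `(A x)(s) = ∫_Ω a(s, t) x(t) dt`. -/
noncomputable def integralOp {d : ℕ} (Ω : Set (EuclideanSpace ℝ (Fin d)))
    (a : EuclideanSpace ℝ (Fin d) → EuclideanSpace ℝ (Fin d) → ℝ)
    (x : EuclideanSpace ℝ (Fin d) → ℝ) (s : EuclideanSpace ℝ (Fin d)) : ℝ :=
  ∫ t in Ω, a s t * x t

/-- The multiplicative factor `A^* (y / (A x))` of an EM step, where `A` is the integral operator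
with kernel `a` from functions on `Ω` to functions on `S`:
`t ↦ ∫_S a(s, t) y(s) / (A x)(s) ds`. -/
noncomputable def emFactor {d : ℕ} (Ω S : Set (EuclideanSpace ℝ (Fin d)))
    (a : EuclideanSpace ℝ (Fin d) → EuclideanSpace ℝ (Fin d) → ℝ)
    (y x : EuclideanSpace ℝ (Fin d) → ℝ) (t : EuclideanSpace ℝ (Fin d)) : ℝ :=
  ∫ s in S, a s t * y s / integralOp Ω a x s

/-- `γ = max { |ln (m₁ / M)|, |ln (M₁ / m)| }`. -/
noncomputable def gammaConst (m M m₁ M₁ : ℝ) : ℝ :=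
  max |Real.log (m₁ / M)| |Real.log (M₁ / m)|

open Classical in
/-- The loping OS-EM iteration: at step `k`, with `j = k mod N`, an EM step for the `j`-th
equation is performed if `d(y_j, A_j x_k) > τ γ δ_j`, and the step is skipped otherwise. -/
noncomputable def lopingIter {d N : ℕ} [NeZero N] (Ω : Set (EuclideanSpace ℝ (Fin d)))
    (S : Fin N → Set (EuclideanSpace ℝ (Fin d)))
    (a : Fin N → EuclideanSpace ℝ (Fin d) → EuclideanSpace ℝ (Fin d) → ℝ)
    (τ γ : ℝ) (x₀ : EuclideanSpace ℝ (Fin d) → ℝ)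
    (δ : Fin N → ℝ) (y : Fin N → EuclideanSpace ℝ (Fin d) → ℝ) :
    ℕ → EuclideanSpace ℝ (Fin d) → ℝ
  | 0 => x₀
  | k + 1 =>
    let x := lopingIter Ω S a τ γ x₀ δ y k
    let j := Fin.ofNat N k
    if ENNReal.ofReal (τ * γ * δ j) < klDist (S j) (y j) (integralOp Ω (a j) x) then
      fun t => x t * emFactor Ω (S j) (a j) (y j) x t
    else x

/-- The multiples `k` of `N` such that the iterates stay fixed (as elements of `L¹(Ω)`) during the
whole cycle of `N` steps that starts at `k`, that is, `x_k = x_{k+1} = ⋯ = x_{k+N}`. -/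
def stopSet {d : ℕ} (N : ℕ) (Ω : Set (EuclideanSpace ℝ (Fin d)))
    (x : ℕ → EuclideanSpace ℝ (Fin d) → ℝ) : Set ℕ :=
  {k | N ∣ k ∧ ∀ i ≤ N, x (k + i) =ᵐ[volume.restrict Ω] x k}

/-- The stopping index of the loping OS-EM iteration: the smallest element of `stopSet`.  (It is
finite exactly when `stopSet` is nonempty.) -/
noncomputable def stopIndex {d N : ℕ} [NeZero N] (Ω : Set (EuclideanSpace ℝ (Fin d)))
    (S : Fin N → Set (EuclideanSpace ℝ (Fin d)))
    (a : Fin N → EuclideanSpace ℝ (Fin d) → EuclideanSpace ℝ (Fin d) → ℝ)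
    (τ γ : ℝ) (x₀ : EuclideanSpace ℝ (Fin d) → ℝ)
    (δ : Fin N → ℝ) (y : Fin N → EuclideanSpace ℝ (Fin d) → ℝ) : ℕ :=
  sInf (stopSet N Ω (lopingIter Ω S a τ γ x₀ δ y))

/-- The iterate at the stopping index. -/
noncomputable def stoppedIterate {d N : ℕ} [NeZero N] (Ω : Set (EuclideanSpace ℝ (Fin d)))
    (S : Fin N → Set (EuclideanSpace ℝ (Fin d)))
    (a : Fin N → EuclideanSpace ℝ (Fin d) → EuclideanSpace ℝ (Fin d) → ℝ)
    (τ γ : ℝ) (x₀ : EuclideanSpace ℝ (Fin d) → ℝ)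
    (δ : Fin N → ℝ) (y : Fin N → EuclideanSpace ℝ (Fin d) → ℝ) :
    EuclideanSpace ℝ (Fin d) → ℝ :=
  lopingIter Ω S a τ γ x₀ δ y (stopIndex Ω S a τ γ x₀ δ y)

/-- `yδ` is noisy data for the exact data `y` with positive noise levels `δ`: each `yδ_j` is
integrable with integral one, satisfies `m₁ ≤ yδ_j ≤ M₁` a.e., and
`‖y_j - yδ_j‖_{L¹} ≤ δ_j`. -/
structure IsNoisyData {d N : ℕ} (S : Fin N → Set (EuclideanSpace ℝ (Fin d))) (m₁ M₁ : ℝ)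
    (y : Fin N → EuclideanSpace ℝ (Fin d) → ℝ) (δ : Fin N → ℝ)
    (yδ : Fin N → EuclideanSpace ℝ (Fin d) → ℝ) : Prop where
  pos : ∀ j, 0 < δ j
  integrable : ∀ j, IntegrableOn (yδ j) (S j)
  noise : ∀ j, ∫ s in S j, |y j s - yδ j s| ≤ δ j
  mass : ∀ j, ∫ s in S j, yδ j s = 1
  bounds : ∀ j, ∀ᵐ s ∂(volume.restrict (S j)), m₁ ≤ yδ j s ∧ yδ j s ≤ M₁

/-- Weak convergence `f n ⇀ z` in `L^p(μ)`: all functions lie in `L^p(μ)` and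
`F (f n) → F z` for every bounded linear functional `F` on `L^p(μ)`. -/
def WeaklyConvergesLp {α : Type*} [MeasurableSpace α] (μ : Measure α) (p : ℝ≥0∞)
    [Fact (1 ≤ p)] (f : ℕ → α → ℝ) (z : α → ℝ) : Prop :=
  ∃ (hf : ∀ n, MemLp (f n) p μ) (hz : MemLp z p μ),
    ∀ F : StrongDual ℝ (Lp ℝ p μ),
      Tendsto (fun n => F ((hf n).toLp (f n))) atTop (𝓝 (F (hz.toLp z)))

end LopingOSEM

/-!
The proof follows the Kullback-Leibler distance `d(z, x_k)` of the iterates to a solution `z` of the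
exact system, where `z` is a probability density at finite distance from `x₀`.

*Descent.*  All iterates are probability densities, so every `A_j x_k` takes values in `[m, M]`, and
`|ln (yδ_j / (A_j x_k))| ≤ γ`.  A performed step multiplies the iterate by a factor `f` and
decreases `d(z, x_k)` by `∫ z ln f`.  Jensen's inequality for the probability density `a_j(·, t)`
and Fubini's theorem bound this decrease below by `∫ y_j ln (yδ_j / (A_j x_k))`, which is at least
`d(yδ_j, A_j x_k) - γ δ_j > (τ - 1) γ δ_j`
(`IsStochasticKernel.sub_le_integral_mul_log_emFactor`, `gain_of_isActive`).  The distances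
`d(z, x_k)` never appear: the iterate is `x₀ P` with a bounded positive function `P`, and the total
decrease `∫ z ln P` is at most `d(z, x₀)` by `integral_mul_log_le_klDist`.  Hence the number of
performed steps is at most `d(z, x₀) / ((τ - 1) γ δ_min)`.  If `γ = 0`, no step is performed, since
`d(yδ_j, A_j x_k) ≤ γ`.

*Stopping.*  Every cycle before the stopping index contains a performed step, which gives the
existence of the index and its bound.  A performed step changes the iterate, so no step of the cycle
at the stopping index is performed, which is the discrepancy estimate.

*Residuals.*  The Kullback-Leibler distance of bounded positive functions dominates the squared `L²`
distance (`sq_sub_le_mul_kl`), so the discrepancy estimate yields convergence of the residuals in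
`L¹`, and in `L^p` because they are bounded.

*Weak limits.*  Bounded sequences in `L^p`, `1 < p < ∞`, have weakly convergent subsequences
(`exists_subseq_weaklyConvergesLp`): every functional on `L^p` is the pairing with a function of
`L^q` (`exists_dual_eq_integral`, by the Radon-Nikodym theorem), and closed balls of the dual of the
separable space `L^q` are weak-* sequentially compact.  Kernels are bounded, so `A_j` maps weak
convergence in `L^p` to pointwise a.e. convergence, and the limit solves the exact system.
-/

namespace LopingOSEM

/-! ### Duality and weak sequential compactness of `L^p` -/

section Duality

variable {α : Type*} [MeasurableSpace α] {μ : Measure α} {p q : ℝ≥0∞}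

theorem pairing_toLp [Fact (1 ≤ p)] [Fact (1 ≤ q)] [q.HolderConjugate p] {f g : α → ℝ}
    (hg : MemLp g q μ) (hf : MemLp f p μ) :
    (ContinuousLinearMap.mul ℝ ℝ).lpPairing μ q p (hg.toLp g) (hf.toLp f) =
      ∫ x, g x * f x ∂μ := by
  rw [ContinuousLinearMap.lpPairing_eq_integral]
  refine integral_congr_ae ?_
  filter_upwards [hg.coeFn_toLp, hf.coeFn_toLp] with x h1 h2
  simp [h1, h2]

variable [IsFiniteMeasure μ]

theorem hasSum_indicatorConstLp [Fact (1 ≤ p)] (hp : p ≠ ∞) {f : ℕ → Set α}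
    (hf : ∀ i, MeasurableSet (f i)) (hd : Pairwise (Function.onFun Disjoint f)) :
    HasSum (fun i => indicatorConstLp p (hf i) (measure_ne_top μ _) (1 : ℝ))
      (indicatorConstLp p (MeasurableSet.iUnion hf) (measure_ne_top μ _) (1 : ℝ)) := by
  have hU : ∀ s : Finset ℕ, MeasurableSet (⋃ i ∈ s, f i) := fun s =>
    Finset.measurableSet_biUnion s fun i _ => hf i
  have hsum : ∀ s : Finset ℕ,
      ∑ i ∈ s, indicatorConstLp p (hf i) (measure_ne_top μ _) (1 : ℝ) =
        indicatorConstLp p (hU s) (measure_ne_top μ _) (1 : ℝ) := by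
    intro s
    induction s using Finset.induction_on with
    | empty => simp
    | insert a s ha ih =>
      have hdis : Disjoint (f a) (⋃ i ∈ s, f i) := by
        simp only [Set.disjoint_iUnion_right]
        intro i hi
        exact hd fun h => ha (h ▸ hi)
      rw [Finset.sum_insert ha, ih, ← indicatorConstLp_disjoint_union (hf a) (hU s)
        (measure_ne_top μ _) (measure_ne_top μ _) hdis]
      congr 1
      simp
  unfold HasSum
  simp only [hsum]
  refine tendsto_indicatorConstLp_set hp ?_
  have hmono : Monotone fun s : Finset ℕ => ⋃ i ∈ s, f i := by
    intro s t hst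
    exact Set.biUnion_subset_biUnion_left hst
  have hunion : (⋃ s : Finset ℕ, ⋃ i ∈ s, f i) = ⋃ i, f i :=
    (Set.iUnion_eq_iUnion_finset f).symm
  have ht := tendsto_measure_iUnion_atTop (μ := μ) hmono
  rw [hunion] at ht
  have hsub : ∀ s : Finset ℕ, (⋃ i ∈ s, f i) ⊆ ⋃ i, f i := fun s =>
    Set.iUnion₂_subset fun i _ => Set.subset_iUnion f i
  have heq : ∀ s : Finset ℕ, μ (symmDiff (⋃ i ∈ s, f i) (⋃ i, f i)) =
      μ (⋃ i, f i) - μ (⋃ i ∈ s, f i) := by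
    intro s
    rw [symmDiff_of_le (hsub s), measure_sdiff (hsub s) (hU s).nullMeasurableSet
      (measure_ne_top μ _)]
  simp only [heq]
  have := ENNReal.Tendsto.sub (tendsto_const_nhds (x := μ (⋃ i, f i)) (f := atTop)) ht
    (Or.inl (measure_ne_top μ _))
  simpa using this

/-- Every bounded functional on `L^p` of a finite measure, `p < ∞`, has an integrable density
on indicator functions: `E ↦ F (1_E)` is an absolutely continuous signed measure. -/
theorem exists_integrable_density [Fact (1 ≤ p)] (hp : p ≠ ∞) (F : StrongDual ℝ (Lp ℝ p μ)) :
    ∃ g : α → ℝ, Measurable g ∧ Integrable g μ ∧ ∀ (s : Set α) (hs : MeasurableSet s),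
      F (indicatorConstLp p hs (measure_ne_top μ _) 1) = ∫ x in s, g x ∂μ := by
  classical
  let ν : SignedMeasure α :=
    { measureOf' := fun s => if hs : MeasurableSet s then
        F (indicatorConstLp p hs (measure_ne_top μ _) 1) else 0
      empty' := by simp
      not_measurable' := fun s hs => by simp [hs]
      m_iUnion' := by
        intro f hf hd
        simp only [hf, MeasurableSet.iUnion hf, dif_pos]
        exact (hasSum_indicatorConstLp hp hf hd).mapL F }
  have hν : ∀ (s : Set α) (hs : MeasurableSet s),
      ν s = F (indicatorConstLp p hs (measure_ne_top μ _) 1) := fun s hs => dif_pos hs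
  have hac : ν ≪ᵥ μ.toENNRealVectorMeasure := by
    refine VectorMeasure.AbsolutelyContinuous.mk fun s hs h0 => ?_
    rw [Measure.toENNRealVectorMeasure_apply_measurable hs] at h0
    rw [hν s hs]
    have : indicatorConstLp p hs (measure_ne_top μ _) (1 : ℝ) = 0 := by
      rw [← norm_eq_zero, norm_indicatorConstLp
        (one_pos.trans_le (Fact.out : 1 ≤ p)).ne' hp]
      have : p.toReal ≠ 0 := by
        rw [Ne, ENNReal.toReal_eq_zero_iff]
        simp [hp, (one_pos.trans_le (Fact.out : 1 ≤ p)).ne']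
      simp [Measure.real, h0, this]
    rw [this, map_zero]
  have hrn := SignedMeasure.withDensityᵥ_rnDeriv_eq ν μ hac
  refine ⟨ν.rnDeriv μ, SignedMeasure.measurable_rnDeriv ν μ, SignedMeasure.integrable_rnDeriv ν μ,
    fun s hs => ?_⟩
  rw [← hν s hs, ← withDensityᵥ_apply (SignedMeasure.integrable_rnDeriv ν μ) hs, hrn]

/-- Two bounded functionals on `L^p`, `p < ∞`, that agree on indicator functions are equal. -/
theorem dual_ext_indicator [Fact (1 ≤ p)] (hp : p ≠ ∞) {F G : StrongDual ℝ (Lp ℝ p μ)}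
    (h : ∀ (s : Set α) (hs : MeasurableSet s),
      F (indicatorConstLp p hs (measure_ne_top μ _) 1) =
        G (indicatorConstLp p hs (measure_ne_top μ _) 1)) : F = G := by
  ext u
  refine Lp.induction hp (motive := fun u => F u = G u) ?_ ?_ ?_ u
  · intro c s hs hμs
    rw [Lp.simpleFunc.coe_indicatorConst]
    have : indicatorConstLp p hs hμs.ne c =
        c • indicatorConstLp p hs (measure_ne_top μ _) (1 : ℝ) := by
      rw [indicatorConstLp, indicatorConstLp, ← MemLp.toLp_const_smul]
      congr 1
      ext x
      by_cases hx : x ∈ s <;> simp [hx]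
    rw [this, map_smul, map_smul, h s hs]
  · intro f g hf hg _ h1 h2
    rw [map_add, map_add, h1, h2]
  · exact isClosed_eq F.continuous G.continuous

/-- The truncated density `g 1_{|g| ≤ n}` represents `F` on the functions that are supported where
`|g| ≤ n`. -/
theorem dual_apply_of_bounded_density [Fact (1 ≤ p)] [Fact (1 ≤ q)] [q.HolderConjugate p]
    (hp : p ≠ ∞) (F : StrongDual ℝ (Lp ℝ p μ)) {g : α → ℝ} (hgm : Measurable g)
    (hg : ∀ (s : Set α) (hs : MeasurableSet s),
      F (indicatorConstLp p hs (measure_ne_top μ _) 1) = ∫ x in s, g x ∂μ)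
    (n : ℕ) {f : α → ℝ} (hf : MemLp f p μ) (hfs : ∀ x, (n : ℝ) < |g x| → f x = 0) :
    F (hf.toLp f) = ∫ x, g x * f x ∂μ := by
  set E : Set α := {x | |g x| ≤ n} with hE
  have hEm : MeasurableSet E := measurableSet_le hgm.abs measurable_const
  have hgE : MemLp (E.indicator g) q μ := by
    refine MemLp.of_bound (hgm.indicator hEm).aestronglyMeasurable n (ae_of_all _ fun x => ?_)
    by_cases hx : x ∈ E
    · rw [Set.indicator_of_mem hx]
      exact hx
    · simp [hx]
  have hw : MemLp (E.indicator fun _ => (1 : ℝ)) ∞ μ := memLp_indicator_const _ hEm _ (Or.inr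
    (measure_ne_top μ _))
  let T : Lp ℝ p μ →L[ℝ] Lp ℝ p μ :=
    (ContinuousLinearMap.mul ℝ ℝ).holderL μ ∞ p p (hw.toLp _)
  have hT : ∀ u : Lp ℝ p μ, (T u : α → ℝ) =ᵐ[μ] E.indicator u := by
    intro u
    filter_upwards [(ContinuousLinearMap.mul ℝ ℝ).coeFn_holder (r := p) (hw.toLp _) u,
      hw.coeFn_toLp] with x h1 h2
    have h3 : (T u : α → ℝ) x = _ := h1
    rw [h3, h2]
    by_cases hx : x ∈ E <;> simp [hx]
  have key : F.comp T = (ContinuousLinearMap.mul ℝ ℝ).lpPairing μ q p (hgE.toLp _) := by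
    refine dual_ext_indicator hp fun s hs => ?_
    have h1 : T (indicatorConstLp p hs (measure_ne_top μ _) 1) =
        indicatorConstLp p (hEm.inter hs) (measure_ne_top μ _) 1 := by
      ext1
      filter_upwards [hT (indicatorConstLp p hs (measure_ne_top μ _) 1),
        indicatorConstLp_coeFn (p := p) (hs := hs) (hμs := measure_ne_top μ _) (c := (1 : ℝ)),
        indicatorConstLp_coeFn (p := p) (hs := hEm.inter hs) (hμs := measure_ne_top μ _)
          (c := (1 : ℝ))] with x h1 h2 h3
      rw [h1, h3]
      by_cases hx : x ∈ E <;> by_cases hx' : x ∈ s <;> simp [hx, hx', h2]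
    rw [ContinuousLinearMap.comp_apply, h1, hg _ (hEm.inter hs)]
    rw [indicatorConstLp, pairing_toLp hgE, ← integral_indicator (hEm.inter hs)]
    congr 1
    ext x
    by_cases hx : x ∈ E <;> by_cases hx' : x ∈ s <;> simp [hx, hx']
  have h2 := DFunLike.congr_fun key (hf.toLp f)
  have h3 : T (hf.toLp f) = hf.toLp f := by
    ext1
    filter_upwards [hT (hf.toLp f), hf.coeFn_toLp] with x h1 h2
    rw [h1]
    by_cases hx : x ∈ E
    · simp [hx]
    · rw [Set.indicator_of_notMem hx, h2, hfs x (not_le.1 hx)]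
  rw [ContinuousLinearMap.comp_apply, h3, pairing_toLp] at h2
  rw [h2]
  congr 1
  ext x
  by_cases hx : x ∈ E
  · simp [hx]
  · simp [hx, hfs x (not_le.1 hx)]

/-- The density of a bounded functional on `L^p`, `1 < p < ∞`, lies in `L^q`: testing with
`sign g |g|^(q-1) 1_{|g| ≤ n}` bounds `∫_{|g| ≤ n} |g|^q` by `‖F‖^q`. -/
theorem memLp_of_density [Fact (1 ≤ p)] [Fact (1 ≤ q)] [q.HolderConjugate p] (h1p : 1 < p)
    (hp : p ≠ ∞) (hq : q ≠ ∞) (F : StrongDual ℝ (Lp ℝ p μ)) {g : α → ℝ} (hgm : Measurable g)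
    (hg : ∀ (s : Set α) (hs : MeasurableSet s),
      F (indicatorConstLp p hs (measure_ne_top μ _) 1) = ∫ x in s, g x ∂μ) :
    MemLp g q μ := by
  have hP : 1 < p.toReal := by
    rw [← ENNReal.toReal_one]; exact (ENNReal.toReal_lt_toReal (by simp) hp).2 h1p
  have : p.HolderConjugate q := ENNReal.HolderConjugate.symm
  have hPQ : p.toReal.HolderConjugate q.toReal := ENNReal.HolderConjugate.toReal hP
  set P := p.toReal with hPdef
  set Q := q.toReal with hQdef
  have hP0 : 0 < P := hPQ.pos
  have hQ0 : 0 < Q := hPQ.symm.pos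
  have hQ1 : 1 < Q := hPQ.symm.lt
  have hp0 : p ≠ 0 := (one_pos.trans h1p).ne'
  have hq0 : q ≠ 0 := (one_pos.trans_le (Fact.out : 1 ≤ q)).ne'
  let E : ℕ → Set α := fun n => {x | |g x| ≤ n}
  have hEm : ∀ n, MeasurableSet (E n) := fun n => measurableSet_le hgm.abs measurable_const
  let f : ℕ → α → ℝ := fun n =>
    (E n).indicator fun x => SignType.sign (g x) * |g x| ^ (Q - 1)
  have hsm : Measurable fun x => ((SignType.sign (g x) : SignType) : ℝ) := by
    have : (fun x => ((SignType.sign (g x) : SignType) : ℝ)) =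
        fun x => if 0 < g x then 1 else if g x < 0 then -1 else 0 := by
      ext x
      rcases lt_trichotomy (g x) 0 with h | h | h
      · simp [sign_neg h, h, not_lt.2 h.le]
      · simp [h]
      · simp [sign_pos h, h]
    rw [this]
    exact Measurable.ite (measurableSet_lt measurable_const hgm) measurable_const
      (Measurable.ite (measurableSet_lt hgm measurable_const) measurable_const measurable_const)
  have habs : ∀ x, |((SignType.sign (g x) : SignType) : ℝ)| ≤ 1 := by
    intro x
    rcases lt_trichotomy (g x) 0 with h | h | h
    · simp [sign_neg h]
    · simp [h]
    · simp [sign_pos h]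
  have hfm : ∀ n, Measurable (f n) := fun n =>
    (hsm.mul (hgm.abs.pow_const _)).indicator (hEm n)
  have hfL : ∀ n, MemLp (f n) p μ := fun n => by
    refine MemLp.of_bound (hfm n).aestronglyMeasurable ((n : ℝ) ^ (Q - 1))
      (ae_of_all _ fun x => ?_)
    by_cases hx : x ∈ E n
    · simp only [f, Set.indicator_of_mem hx, Real.norm_eq_abs, abs_mul]
      rw [abs_of_nonneg (Real.rpow_nonneg (abs_nonneg (g x)) _)]
      calc _ ≤ 1 * |g x| ^ (Q - 1) := by gcongr; exact habs x
        _ ≤ _ := by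
          rw [one_mul]
          exact Real.rpow_le_rpow (abs_nonneg _) hx (by linarith)
    · simp only [f, Set.indicator_of_notMem hx, norm_zero]
      positivity
  have hgf : ∀ n x, g x * f n x = (E n).indicator (fun x => |g x| ^ Q) x := by
    intro n x
    by_cases hx : x ∈ E n
    · simp only [f, Set.indicator_of_mem hx]
      rcases eq_or_ne (g x) 0 with h | h
      · simp [h, Real.zero_rpow hQ0.ne']
      · rw [← mul_assoc, self_mul_sign]
        nth_rewrite 1 [← Real.rpow_one |g x|]
        rw [← Real.rpow_add (abs_pos.2 h)]
        ring_nf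
    · simp [f, hx]
  -- `(Q - 1) P = Q` for conjugate exponents.
  have hfP : ∀ n x, ‖f n x‖ ^ P = (E n).indicator (fun x => |g x| ^ Q) x := by
    intro n x
    by_cases hx : x ∈ E n
    · simp only [f, Set.indicator_of_mem hx, Real.norm_eq_abs, abs_mul]
      rcases eq_or_ne (g x) 0 with h | h
      · simp [h, Real.zero_rpow hQ0.ne', Real.zero_rpow hP0.ne']
      · have : |((SignType.sign (g x) : SignType) : ℝ)| = 1 := by
          rcases lt_or_gt_of_ne h with h | h
          · simp [sign_neg h]
          · simp [sign_pos h]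
        rw [this, one_mul, abs_of_nonneg (Real.rpow_nonneg (abs_nonneg (g x)) _),
          ← Real.rpow_mul (abs_nonneg _)]
        congr 1
        rw [sub_mul, one_mul]
        linarith [hPQ.mul_eq_add]
    · simp [f, hx, Real.zero_rpow hP0.ne']
  let I : ℕ → ℝ := fun n => ∫ x, (E n).indicator (fun x => |g x| ^ Q) x ∂μ
  have hI0 : ∀ n, 0 ≤ I n := fun n => integral_nonneg fun x =>
    Set.indicator_nonneg (fun y _ => Real.rpow_nonneg (abs_nonneg _) _) x
  have hI : ∀ n, I n ≤ ‖F‖ * I n ^ P⁻¹ := by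
    intro n
    have h1 := dual_apply_of_bounded_density (q := q) hp F hgm hg n (hfL n) (by
      intro x hx
      have hx' : x ∉ E n := not_le.2 hx
      simp [f, hx'])
    simp only [hgf] at h1
    have h2 : ‖(hfL n).toLp (f n)‖ = I n ^ P⁻¹ := by
      rw [Lp.norm_toLp, (hfL n).eLpNorm_eq_integral_rpow_norm hp0 hp]
      simp only [← hPdef, hfP]
      rw [ENNReal.toReal_ofReal (Real.rpow_nonneg (hI0 n) _)]
    calc I n = F ((hfL n).toLp (f n)) := h1.symm
      _ ≤ ‖F ((hfL n).toLp (f n))‖ := le_abs_self _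
      _ ≤ ‖F‖ * ‖(hfL n).toLp (f n)‖ := F.le_opNorm _
      _ = _ := by rw [h2]
  have hIb : ∀ n, I n ≤ ‖F‖ ^ Q := by
    intro n
    rcases (hI0 n).eq_or_lt with h | h
    · rw [← h]; positivity
    · have h1 : I n ^ Q⁻¹ ≤ ‖F‖ := by
        have h2 : I n ^ Q⁻¹ * I n ^ P⁻¹ = I n := by
          rw [← Real.rpow_add h, add_comm, hPQ.inv_add_inv_eq_one, Real.rpow_one]
        have h3 : 0 < I n ^ P⁻¹ := Real.rpow_pos_of_pos h _
        refine le_of_mul_le_mul_right ?_ h3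
        rw [h2]; exact hI n
      calc I n = (I n ^ Q⁻¹) ^ Q := by
            rw [← Real.rpow_mul (hI0 n), inv_mul_cancel₀ hQ0.ne', Real.rpow_one]
        _ ≤ _ := Real.rpow_le_rpow (Real.rpow_nonneg (hI0 n) _) h1 hQ0.le
  refine ⟨hgm.aestronglyMeasurable, ?_⟩
  rw [eLpNorm_lt_top_iff_lintegral_rpow_enorm_lt_top hq0 hq]
  refine lt_of_le_of_lt ?_ (ENNReal.ofReal_lt_top (r := ‖F‖ ^ Q))
  have hlim : ∀ x, ‖g x‖ₑ ^ Q =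
      ⨆ n, ENNReal.ofReal ((E n).indicator (fun x => |g x| ^ Q) x) := by
    intro x
    have h0 : ‖g x‖ₑ ^ Q = ENNReal.ofReal (|g x| ^ Q) := by
      rw [Real.enorm_eq_ofReal_abs, ENNReal.ofReal_rpow_of_nonneg (abs_nonneg _) hQ0.le]
    rw [h0]
    refine le_antisymm ?_ (iSup_le fun n => ENNReal.ofReal_le_ofReal
      (Set.indicator_le_self' (fun _ _ => Real.rpow_nonneg (abs_nonneg _) _) x))
    obtain ⟨n, hn⟩ := exists_nat_ge |g x|
    refine le_iSup_of_le n ?_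
    rw [Set.indicator_of_mem (show x ∈ E n from hn)]
  simp only [← hQdef, hlim]
  rw [lintegral_iSup]
  · refine iSup_le fun n => ?_
    rw [← ofReal_integral_eq_lintegral_ofReal]
    · exact ENNReal.ofReal_le_ofReal (hIb n)
    · refine Integrable.of_bound ((hgm.abs.pow_const _).indicator (hEm n)).aestronglyMeasurable
        ((n : ℝ) ^ Q) (ae_of_all _ fun x => ?_)
      by_cases hx : x ∈ E n
      · rw [Set.indicator_of_mem hx, Real.norm_of_nonneg (by positivity)]
        exact Real.rpow_le_rpow (abs_nonneg _) hx hQ0.le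
      · rw [Set.indicator_of_notMem hx, norm_zero]
        positivity
    · exact ae_of_all _ fun x => Set.indicator_nonneg
        (fun y _ => Real.rpow_nonneg (abs_nonneg _) _) x
  · exact fun n => ((hgm.abs.pow_const _).indicator (hEm n)).ennreal_ofReal
  · intro n k hnk x
    refine ENNReal.ofReal_le_ofReal (Set.indicator_le_indicator_of_subset ?_
      (fun _ => Real.rpow_nonneg (abs_nonneg _) _) x)
    intro z hz
    have hz' : |g z| ≤ n := hz
    exact hz'.trans (by exact_mod_cast hnk)

/-- **Riesz representation** for `L^p`: for a finite measure and `1 < p < ∞`, every bounded functional on `L^p`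
is the pairing with a function of `L^q`. -/
theorem exists_dual_eq_integral [Fact (1 ≤ p)] [Fact (1 ≤ q)] [q.HolderConjugate p] (h1p : 1 < p)
    (hp : p ≠ ∞) (hq : q ≠ ∞) (F : StrongDual ℝ (Lp ℝ p μ)) :
    ∃ g : α → ℝ, ∃ hg : MemLp g q μ,
      F = (ContinuousLinearMap.mul ℝ ℝ).lpPairing μ q p (hg.toLp g) := by
  obtain ⟨g, hgm, -, hgF⟩ := exists_integrable_density hp F
  have hg := memLp_of_density (q := q) h1p hp hq F hgm hgF
  refine ⟨g, hg, dual_ext_indicator hp fun s hs => ?_⟩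
  rw [hgF s hs, indicatorConstLp, pairing_toLp hg, ← integral_indicator hs]
  congr 1
  ext x
  by_cases hx : x ∈ s <;> simp [hx]

/-- Weak sequential compactness of bounded sets of `L^p`, `1 < p < ∞`, in a space with countably
generated σ-algebra: `L^p` is the dual of the separable space `L^q`, and conversely. -/
theorem exists_subseq_weaklyConvergesLp [MeasurableSpace.CountablyGenerated α] [Fact (1 ≤ p)]
    (h1p : 1 < p) (hp : p ≠ ∞) {f : ℕ → α → ℝ} (hf : ∀ n, MemLp (f n) p μ) {B : ℝ≥0∞}
    (hB : B ≠ ∞) (hfB : ∀ n, eLpNorm (f n) p μ ≤ B) :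
    ∃ (φ : ℕ → ℕ) (z : α → ℝ), StrictMono φ ∧ MemLp z p μ ∧
      WeaklyConvergesLp μ p (fun i => f (φ i)) z := by
  obtain ⟨q, hpq, h1q, hq⟩ : ∃ q : ℝ≥0∞, p.HolderConjugate q ∧ 1 < q ∧ q ≠ ∞ := by
    have := ENNReal.HolderConjugate.conjExponent h1p.le
    refine ⟨ENNReal.conjExponent p, this, ?_, ?_⟩
    · exact ENNReal.lt_add_right ENNReal.one_ne_top
        (ENNReal.inv_ne_zero.2 (ENNReal.sub_ne_top hp))
    · exact ENNReal.add_ne_top.2 ⟨ENNReal.one_ne_top,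
        ENNReal.inv_ne_top.2 (tsub_pos_of_lt h1p).ne'⟩
  have := hpq
  have : q.HolderConjugate p := ENNReal.HolderConjugate.symm
  have : Fact (1 ≤ q) := ⟨h1q.le⟩
  have : Fact (q ≠ ∞) := ⟨hq⟩
  let Λ := (ContinuousLinearMap.mul ℝ ℝ).lpPairing μ p q
  have hmem : ∀ n, (StrongDual.toWeakDual (Λ ((hf n).toLp (f n))) : WeakDual ℝ (Lp ℝ q μ)) ∈
      WeakDual.toStrongDual ⁻¹' Metric.closedBall (0 : StrongDual ℝ (Lp ℝ q μ))
        (‖Λ‖ * B.toReal) := by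
    intro n
    rw [Set.mem_preimage, mem_closedBall_zero_iff]
    refine (Λ.le_opNorm _).trans ?_
    gcongr
    rw [Lp.norm_toLp]
    exact ENNReal.toReal_mono hB (hfB n)
  obtain ⟨Φ, -, φ, hφ, hlim⟩ := WeakDual.isSeqCompact_closedBall ℝ (Lp ℝ q μ) 0 _ hmem
  obtain ⟨z, hz, hzΦ⟩ := exists_dual_eq_integral (q := p) h1q hq hp (WeakDual.toStrongDual Φ)
  refine ⟨φ, z, hφ, hz, fun i => hf (φ i), hz, fun F => ?_⟩
  obtain ⟨g, hg, rfl⟩ := exists_dual_eq_integral (q := q) h1p hp hq F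
  have h1 := ((WeakDual.eval_continuous (hg.toLp g)).tendsto Φ).comp hlim
  have h2 : Φ (hg.toLp g) = ∫ x, z x * g x ∂μ := by
    rw [← pairing_toLp hz hg, ← hzΦ]
    rfl
  have h3 : ∀ i, ((StrongDual.toWeakDual (Λ ((hf (φ i)).toLp (f (φ i)))) :
      WeakDual ℝ (Lp ℝ q μ)) : Lp ℝ q μ → ℝ) (hg.toLp g) = ∫ x, f (φ i) x * g x ∂μ := by
    intro i
    exact pairing_toLp (hf (φ i)) hg
  simp only [Function.comp_def, h2, h3] at h1
  simp only [pairing_toLp]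
  simpa only [mul_comm] using h1

end Duality

/-! ### Pointwise inequalities for the Kullback-Leibler integrand -/

section Pointwise

/-- The scalar Kullback-Leibler integrand dominates the squared difference: with `r = √u` and
`s = √v` it is at least `(s - r)²`, and `(v - u)² = (s - r)² (s + r)²`. -/
theorem sq_sub_le_mul_kl {u v K : ℝ} (hu : 0 < u) (hv : 0 < v) (huK : u ≤ K) (hvK : v ≤ K) :
    (v - u) ^ 2 ≤ 4 * K * (v * Real.log (v / u) - v + u) := by
  obtain ⟨r, hr, rfl⟩ : ∃ r, 0 < r ∧ u = r ^ 2 :=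
    ⟨√u, Real.sqrt_pos.2 hu, (Real.sq_sqrt hu.le).symm⟩
  obtain ⟨s, hs, rfl⟩ : ∃ s, 0 < s ∧ v = s ^ 2 :=
    ⟨√v, Real.sqrt_pos.2 hv, (Real.sq_sqrt hv.le).symm⟩
  have h1 : 1 - (s / r)⁻¹ ≤ Real.log (s / r) := Real.one_sub_inv_le_log_of_pos (div_pos hs hr)
  have h2 : Real.log (s ^ 2 / r ^ 2) = 2 * Real.log (s / r) := by
    rw [← div_pow, Real.log_pow]; norm_num
  have h3 : (s - r) ^ 2 ≤ s ^ 2 * Real.log (s ^ 2 / r ^ 2) - s ^ 2 + r ^ 2 := by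
    have h4 : s ^ 2 * (2 * (1 - (s / r)⁻¹)) ≤ s ^ 2 * (2 * Real.log (s / r)) := by gcongr
    have h5 : s ^ 2 * (2 * (1 - (s / r)⁻¹)) = 2 * s ^ 2 - 2 * s * r := by
      rw [inv_div]; field_simp
    rw [h2]
    nlinarith
  have hK : (s + r) ^ 2 ≤ 4 * K := by nlinarith [sq_nonneg (s - r)]
  calc (s ^ 2 - r ^ 2) ^ 2 = (s + r) ^ 2 * (s - r) ^ 2 := by ring
    _ ≤ 4 * K * (s - r) ^ 2 := by gcongr
    _ ≤ _ := by
      have : 0 ≤ 4 * K := le_trans (sq_nonneg _) hK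
      gcongr

theorem kl_nonneg {u v : ℝ} (hu : 0 < u) (hv : 0 < v) : 0 ≤ v * Real.log (v / u) - v + u := by
  have h := sq_sub_le_mul_kl hu hv (le_max_left u v) (le_max_right u v)
  exact nonneg_of_mul_nonneg_right ((sq_nonneg _).trans h)
    (mul_pos four_pos (lt_max_of_lt_left hu))

theorem measurable_klIntegrand : Measurable fun q : ℝ × ℝ => klIntegrand q.1 q.2 := by
  unfold klIntegrand
  refine Measurable.ite ?_ measurable_const ?_
  · exact (measurableSet_eq_fun measurable_snd measurable_const).inter
      (measurableSet_eq_fun measurable_fst measurable_const).compl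
  · fun_prop

/-- Young's inequality behind the variational formula for the Kullback-Leibler distance. -/
theorem mul_log_le_klIntegrand {u v P : ℝ} (hu : 0 ≤ u) (hv : 0 ≤ v) (hP : 0 < P)
    (h : klIntegrand v u ≠ ∞) : v * Real.log P + u - u * P ≤ (klIntegrand v u).toReal := by
  unfold klIntegrand at h ⊢
  split_ifs at h ⊢ with h0
  · exact absurd rfl h
  rcases hv.eq_or_lt with rfl | hv
  · simp only [zero_mul, zero_add, sub_zero]
    rw [ENNReal.toReal_ofReal hu]
    linarith [mul_nonneg hu hP.le]
  have hu' : 0 < u := hu.lt_of_ne fun h => h0 ⟨h.symm, hv.ne'⟩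
  rw [ENNReal.toReal_ofReal (kl_nonneg hu' hv)]
  have h1 := Real.log_le_sub_one_of_pos (div_pos (mul_pos hu' hP) hv)
  have h2 : Real.log (u * P / v) = Real.log P - Real.log (v / u) := by
    rw [Real.log_div (mul_pos hu' hP).ne' hv.ne', Real.log_mul hu'.ne' hP.ne',
      Real.log_div hv.ne' hu'.ne']
    ring
  have h3 := mul_le_mul_of_nonneg_left h1 hv.le
  have h4 : v * (u * P / v - 1) = u * P - v := by field_simp
  rw [h2, h4] at h3
  linarith

end Pointwise

/-! ### One EM step for a stochastic kernel -/

section Kernel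

variable {d : ℕ} {Ω S : Set (EuclideanSpace ℝ (Fin d))}
  {a : EuclideanSpace ℝ (Fin d) → EuclideanSpace ℝ (Fin d) → ℝ} {m M : ℝ}

/-- A kernel on `S × Ω` with values in `[m, M]`, `m > 0`, whose integral over `S` is one: its
integral operator maps probability densities on `Ω` to probability densities on `S`. -/
structure IsStochasticKernel (Ω S : Set (EuclideanSpace ℝ (Fin d)))
    (a : EuclideanSpace ℝ (Fin d) → EuclideanSpace ℝ (Fin d) → ℝ) (m M : ℝ) : Prop where
  pos : 0 < m
  meas : AEStronglyMeasurable (fun q => a q.1 q.2)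
    ((volume.restrict S).prod (volume.restrict Ω))
  mass : ∀ᵐ t ∂(volume.restrict Ω), ∫ s in S, a s t = 1
  bounds : ∀ᵐ q ∂((volume.restrict S).prod (volume.restrict Ω)), m ≤ a q.1 q.2 ∧ a q.1 q.2 ≤ M

/-- A probability density on `D`. -/
structure IsDensity (D : Set (EuclideanSpace ℝ (Fin d))) (x : EuclideanSpace ℝ (Fin d) → ℝ) :
    Prop where
  integrable : IntegrableOn x D
  nonneg : ∀ᵐ t ∂(volume.restrict D), 0 ≤ x t
  mass : ∫ t in D, x t = 1

namespace IsStochasticKernel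

theorem bounds_left (K : IsStochasticKernel Ω S a m M) :
    ∀ᵐ s ∂(volume.restrict S), ∀ᵐ t ∂(volume.restrict Ω), m ≤ a s t ∧ a s t ≤ M :=
  Measure.ae_ae_of_ae_prod K.bounds

theorem bounds_right (K : IsStochasticKernel Ω S a m M) :
    ∀ᵐ t ∂(volume.restrict Ω), ∀ᵐ s ∂(volume.restrict S), m ≤ a s t ∧ a s t ≤ M := by
  have h := K.bounds
  rw [← Measure.prod_swap] at h
  exact Measure.ae_ae_of_ae_prod (ae_of_ae_map measurable_swap.aemeasurable h)

theorem meas_left (K : IsStochasticKernel Ω S a m M) :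
    ∀ᵐ s ∂(volume.restrict S), AEStronglyMeasurable (a s) (volume.restrict Ω) :=
  K.meas.prodMk_left

theorem meas_right (K : IsStochasticKernel Ω S a m M) :
    ∀ᵐ t ∂(volume.restrict Ω), AEStronglyMeasurable (fun s => a s t) (volume.restrict S) :=
  K.meas.prod_swap.prodMk_left

theorem abs_bound {c : ℝ} (hm : 0 < m) (h : m ≤ c ∧ c ≤ M) : ‖c‖ ≤ M := by
  rw [Real.norm_of_nonneg (hm.le.trans h.1)]; exact h.2

theorem integrable_left (K : IsStochasticKernel Ω S a m M)
    {x : EuclideanSpace ℝ (Fin d) → ℝ} (hx : IntegrableOn x Ω) :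
    ∀ᵐ s ∂(volume.restrict S), IntegrableOn (fun t => a s t * x t) Ω := by
  filter_upwards [K.bounds_left, K.meas_left] with s hs hsm
  exact Integrable.bdd_mul hx hsm (hs.mono fun t ht => abs_bound K.pos ht)

theorem integrable_right (K : IsStochasticKernel Ω S a m M)
    {w : EuclideanSpace ℝ (Fin d) → ℝ} (hw : IntegrableOn w S) :
    ∀ᵐ t ∂(volume.restrict Ω), IntegrableOn (fun s => a s t * w s) S := by
  filter_upwards [K.bounds_right, K.meas_right] with s hs hsm
  exact Integrable.bdd_mul hw hsm (hs.mono fun t ht => abs_bound K.pos ht)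

/-- Integrability of the kernel against a product of integrable functions, as the kernel is
bounded; this is what Fubini's theorem needs. -/
theorem integrable_prod (K : IsStochasticKernel Ω S a m M)
    {w x : EuclideanSpace ℝ (Fin d) → ℝ} (hw : IntegrableOn w S) (hx : IntegrableOn x Ω) :
    Integrable (fun q : EuclideanSpace ℝ (Fin d) × EuclideanSpace ℝ (Fin d) =>
      a q.1 q.2 * (w q.1 * x q.2)) ((volume.restrict S).prod (volume.restrict Ω)) :=
  Integrable.bdd_mul (hw.mul_prod hx) K.meas (K.bounds.mono fun _ h => abs_bound K.pos h)

/-- The adjoint of the integral operator, by Fubini's theorem. -/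
theorem integral_mul_integralOp (K : IsStochasticKernel Ω S a m M)
    {w x : EuclideanSpace ℝ (Fin d) → ℝ} (hw : IntegrableOn w S) (hx : IntegrableOn x Ω) :
    ∫ s in S, w s * integralOp Ω a x s = ∫ t in Ω, x t * ∫ s in S, a s t * w s := by
  have h := integral_integral_swap (f := fun s t => a s t * (w s * x t)) (K.integrable_prod hw hx)
  have h1 : ∀ s, ∫ t in Ω, a s t * (w s * x t) = w s * integralOp Ω a x s := by
    intro s
    rw [integralOp, ← integral_const_mul]
    congr 1; ext t; ring
  have h2 : ∀ t, ∫ s in S, a s t * (w s * x t) = x t * ∫ s in S, a s t * w s := by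
    intro t
    rw [← integral_const_mul]
    congr 1; ext s; ring
  simpa only [h1, h2] using h

theorem integrable_integralOp [IsFiniteMeasure (volume.restrict S)]
    (K : IsStochasticKernel Ω S a m M)
    {x : EuclideanSpace ℝ (Fin d) → ℝ} (hx : IntegrableOn x Ω) :
    IntegrableOn (integralOp Ω a x) S := by
  have h := (K.integrable_prod (w := fun _ => 1) (integrable_const 1) hx).integral_prod_left
  simp only [one_mul] at h
  exact h

theorem integral_integralOp [IsFiniteMeasure (volume.restrict S)]
    (K : IsStochasticKernel Ω S a m M)
    {x : EuclideanSpace ℝ (Fin d) → ℝ} (hx : IntegrableOn x Ω) :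
    ∫ s in S, integralOp Ω a x s = ∫ t in Ω, x t := by
  have h := K.integral_mul_integralOp (w := fun _ => 1) (integrable_const 1) hx
  simp only [one_mul, mul_one] at h
  rw [h]
  refine integral_congr_ae ?_
  filter_upwards [K.mass] with t ht
  rw [ht, mul_one]

theorem integralOp_bounds (K : IsStochasticKernel Ω S a m M)
    {x : EuclideanSpace ℝ (Fin d) → ℝ} (hx : IsDensity Ω x) :
    ∀ᵐ s ∂(volume.restrict S), m ≤ integralOp Ω a x s ∧ integralOp Ω a x s ≤ M := by
  filter_upwards [K.bounds_left, K.integrable_left hx.integrable] with s hs hi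
  have h1 : ∀ c : ℝ, ∫ t in Ω, c * x t = c := fun c => by
    rw [integral_const_mul, hx.mass, mul_one]
  constructor
  · rw [← h1 m]
    refine integral_mono_ae (hx.integrable.const_mul m) hi ?_
    filter_upwards [hs, hx.nonneg] with t ht hxt
    exact mul_le_mul_of_nonneg_right ht.1 hxt
  · rw [← h1 M]
    refine integral_mono_ae hi (hx.integrable.const_mul M) ?_
    filter_upwards [hs, hx.nonneg] with t ht hxt
    exact mul_le_mul_of_nonneg_right ht.2 hxt

/-- The quotient `y / (A x)` is integrable, as `A x` is bounded below by `m > 0`. -/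
theorem integrable_div [IsFiniteMeasure (volume.restrict S)] (K : IsStochasticKernel Ω S a m M)
    {x y : EuclideanSpace ℝ (Fin d) → ℝ} (hx : IsDensity Ω x) (hy : IntegrableOn y S) :
    IntegrableOn (fun s => y s / integralOp Ω a x s) S := by
  have h := Integrable.bdd_mul (c := m⁻¹) hy
    (f := fun s => (integralOp Ω a x s)⁻¹)
    (K.integrable_integralOp hx.integrable).aestronglyMeasurable.aemeasurable.inv.aestronglyMeasurable
    (by
      filter_upwards [K.integralOp_bounds hx] with s hs
      rw [norm_inv, Real.norm_of_nonneg (K.pos.le.trans hs.1)]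
      exact inv_anti₀ K.pos hs.1)
  simp only [div_eq_inv_mul]
  exact h

theorem emFactor_eq (x y : EuclideanSpace ℝ (Fin d) → ℝ) (t : EuclideanSpace ℝ (Fin d)) :
    emFactor Ω S a y x t = ∫ s in S, a s t * (y s / integralOp Ω a x s) := by
  simp only [emFactor, mul_div_assoc]

theorem emFactor_bounds [IsFiniteMeasure (volume.restrict S)]
    (K : IsStochasticKernel Ω S a m M) (hM : 0 < M)
    {x y : EuclideanSpace ℝ (Fin d) → ℝ} (hx : IsDensity Ω x) (hy : IsDensity S y) :
    ∀ᵐ t ∂(volume.restrict Ω), m / M ≤ emFactor Ω S a y x t ∧ emFactor Ω S a y x t ≤ M / m := by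
  filter_upwards [K.bounds_right, K.integrable_right (K.integrable_div hx hy.integrable)]
    with t ht hi
  have h1 : ∀ c : ℝ, ∫ s in S, c * y s = c := fun c => by
    rw [integral_const_mul, hy.mass, mul_one]
  rw [emFactor_eq]
  constructor
  · rw [← h1 (m / M)]
    refine integral_mono_ae (hy.integrable.const_mul _) hi ?_
    filter_upwards [ht, hy.nonneg, K.integralOp_bounds hx] with s hs hys hAs
    have hA : 0 < integralOp Ω a x s := K.pos.trans_le hAs.1
    show m / M * y s ≤ a s t * (y s / integralOp Ω a x s)
    rw [div_mul_eq_mul_div, mul_div_assoc]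
    have : y s / M ≤ y s / integralOp Ω a x s := div_le_div_of_nonneg_left hys hA hAs.2
    exact mul_le_mul hs.1 this (div_nonneg hys hM.le) (K.pos.le.trans hs.1)
  · rw [← h1 (M / m)]
    refine integral_mono_ae hi (hy.integrable.const_mul _) ?_
    filter_upwards [ht, hy.nonneg, K.integralOp_bounds hx] with s hs hys hAs
    have hA : 0 < integralOp Ω a x s := K.pos.trans_le hAs.1
    show a s t * (y s / integralOp Ω a x s) ≤ M / m * y s
    rw [div_mul_eq_mul_div, mul_div_assoc]
    have : y s / integralOp Ω a x s ≤ y s / m := div_le_div_of_nonneg_left hys K.pos hAs.1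
    exact mul_le_mul hs.2 this (div_nonneg hys hA.le) hM.le

theorem aestronglyMeasurable_emFactor [IsFiniteMeasure (volume.restrict Ω)]
    [IsFiniteMeasure (volume.restrict S)] (K : IsStochasticKernel Ω S a m M)
    {x y : EuclideanSpace ℝ (Fin d) → ℝ} (hx : IsDensity Ω x) (hy : IntegrableOn y S) :
    AEStronglyMeasurable (emFactor Ω S a y x) (volume.restrict Ω) := by
  have h := (K.integrable_prod (x := fun _ => 1) (K.integrable_div hx hy)
    (integrable_const 1)).integral_prod_right
  simp only [mul_one] at h
  exact h.aestronglyMeasurable.congr (ae_of_all _ fun t => (emFactor_eq x y t).symm)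

/-- An EM step preserves probability densities. -/
theorem isDensity_mul_emFactor [IsFiniteMeasure (volume.restrict Ω)]
    [IsFiniteMeasure (volume.restrict S)] (K : IsStochasticKernel Ω S a m M) (hM : 0 < M)
    {x y : EuclideanSpace ℝ (Fin d) → ℝ} (hx : IsDensity Ω x) (hy : IsDensity S y) :
    IsDensity Ω fun t => x t * emFactor Ω S a y x t := by
  refine ⟨?_, ?_, ?_⟩
  · have h := Integrable.bdd_mul (c := M / m) hx.integrable
      (K.aestronglyMeasurable_emFactor hx hy.integrable) (by
        filter_upwards [K.emFactor_bounds hM hx hy] with t ht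
        rw [Real.norm_of_nonneg ((div_pos K.pos hM).le.trans ht.1)]
        exact ht.2)
    simp only [mul_comm (x _)]
    exact h
  · filter_upwards [hx.nonneg, K.emFactor_bounds hM hx hy] with t h1 h2
    exact mul_nonneg h1 ((div_pos K.pos hM).le.trans h2.1)
  · simp only [emFactor_eq]
    rw [← K.integral_mul_integralOp (K.integrable_div hx hy.integrable) hx.integrable, ← hy.mass]
    refine integral_congr_ae ?_
    filter_upwards [K.integralOp_bounds hx] with s hs
    exact div_mul_cancel₀ _ (K.pos.trans_le hs.1).ne'

/-- Jensen's inequality for the logarithm and the probability density `a(·, t)`, from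
`log (w / f) ≤ w / f - 1` with `w = y / (A x)` and `f` the factor of the EM step. -/
theorem integral_log_le_log_emFactor [IsFiniteMeasure (volume.restrict S)]
    (K : IsStochasticKernel Ω S a m M) (hM : 0 < M)
    {x y : EuclideanSpace ℝ (Fin d) → ℝ} (hx : IsDensity Ω x) (hy : IsDensity S y)
    (hpos : ∀ᵐ s ∂(volume.restrict S), 0 < y s)
    (hlog : IntegrableOn (fun s => Real.log (y s / integralOp Ω a x s)) S) :
    ∀ᵐ t ∂(volume.restrict Ω),
      ∫ s in S, a s t * Real.log (y s / integralOp Ω a x s) ≤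
        Real.log (emFactor Ω S a y x t) := by
  filter_upwards [K.bounds_right, K.mass, K.emFactor_bounds hM hx hy,
    K.integrable_right (K.integrable_div hx hy.integrable), K.integrable_right hlog,
    K.integrable_right (w := fun _ => 1) (integrable_const 1)] with t ht hmass hf hi hil hi1
  have hf0 : 0 < emFactor Ω S a y x t := (div_pos K.pos hM).trans_le hf.1
  set f := emFactor Ω S a y x t with hfdef
  have hfe : ∫ s in S, a s t * (y s / integralOp Ω a x s) = f := by rw [hfdef, emFactor_eq]
  have h1 : ∫ s in S, ((Real.log f - 1) * (a s t * 1) +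
      f⁻¹ * (a s t * (y s / integralOp Ω a x s))) = Real.log f := by
    rw [integral_add (hi1.const_mul _) (hi.const_mul _), integral_const_mul, integral_const_mul,
      hfe]
    simp only [mul_one]
    rw [hmass, inv_mul_cancel₀ hf0.ne']
    ring
  rw [← h1]
  refine integral_mono_ae hil ((hi1.const_mul _).add (hi.const_mul _)) ?_
  filter_upwards [ht, hpos, K.integralOp_bounds hx] with s hs hys hA
  have hw : 0 < y s / integralOp Ω a x s := div_pos hys (K.pos.trans_le hA.1)
  have h2 := Real.log_le_sub_one_of_pos (div_pos hw hf0)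
  rw [Real.log_div hw.ne' hf0.ne'] at h2
  have h3 : Real.log (y s / integralOp Ω a x s) ≤
      Real.log f - 1 + f⁻¹ * (y s / integralOp Ω a x s) := by
    rw [← div_eq_inv_mul]; linarith
  have h4 := mul_le_mul_of_nonneg_left h3 (K.pos.le.trans hs.1)
  calc _ ≤ _ := h4
    _ = _ := by ring

theorem abs_log_div_le (K : IsStochasticKernel Ω S a m M) (hM : 0 < M) {m₁ M₁ : ℝ} (hm₁ : 0 < m₁)
    {x y : EuclideanSpace ℝ (Fin d) → ℝ} (hx : IsDensity Ω x)
    (hyb : ∀ᵐ s ∂(volume.restrict S), m₁ ≤ y s ∧ y s ≤ M₁) :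
    ∀ᵐ s ∂(volume.restrict S),
      |Real.log (y s / integralOp Ω a x s)| ≤ gammaConst m M m₁ M₁ := by
  filter_upwards [hyb, K.integralOp_bounds hx] with s hys hA
  have hA0 : 0 < integralOp Ω a x s := K.pos.trans_le hA.1
  have hy0 : 0 < y s := hm₁.trans_le hys.1
  refine abs_le_max_abs_abs (Real.log_le_log (div_pos hm₁ hM) ?_)
    (Real.log_le_log (div_pos hy0 hA0) ?_)
  · exact div_le_div₀ hy0.le hys.1 hA0 hA.2
  · exact div_le_div₀ (hy0.le.trans hys.2) hys.2 K.pos hA.1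

theorem integrable_log_div [IsFiniteMeasure (volume.restrict S)]
    (K : IsStochasticKernel Ω S a m M) (hM : 0 < M) {m₁ M₁ : ℝ} (hm₁ : 0 < m₁)
    {x y : EuclideanSpace ℝ (Fin d) → ℝ} (hx : IsDensity Ω x) (hy : IntegrableOn y S)
    (hyb : ∀ᵐ s ∂(volume.restrict S), m₁ ≤ y s ∧ y s ≤ M₁) :
    IntegrableOn (fun s => Real.log (y s / integralOp Ω a x s)) S :=
  Integrable.of_bound (Real.measurable_log.comp_aemeasurable
    (K.integrable_div hx hy).aestronglyMeasurable.aemeasurable).aestronglyMeasurable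
    (gammaConst m M m₁ M₁) (K.abs_log_div_le hM hm₁ hx hyb)

theorem integrable_mul_log_div [IsFiniteMeasure (volume.restrict S)]
    (K : IsStochasticKernel Ω S a m M) (hM : 0 < M) {m₁ M₁ : ℝ} (hm₁ : 0 < m₁)
    {x y v : EuclideanSpace ℝ (Fin d) → ℝ} (hx : IsDensity Ω x) (hy : IntegrableOn y S)
    (hyb : ∀ᵐ s ∂(volume.restrict S), m₁ ≤ y s ∧ y s ≤ M₁) (hv : IntegrableOn v S) :
    IntegrableOn (fun s => v s * Real.log (y s / integralOp Ω a x s)) S :=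
  hv.mul_bdd (K.integrable_log_div hM hm₁ hx hy hyb).aestronglyMeasurable
    (K.abs_log_div_le hM hm₁ hx hyb)

/-- For densities the Kullback-Leibler distance is `∫ y ln (y / (A x))`, since the integrals of the
other two terms of its integrand cancel. -/
theorem klDist_integralOp [IsFiniteMeasure (volume.restrict S)]
    (K : IsStochasticKernel Ω S a m M) (hM : 0 < M) {m₁ M₁ : ℝ} (hm₁ : 0 < m₁)
    {x y : EuclideanSpace ℝ (Fin d) → ℝ} (hx : IsDensity Ω x) (hy : IsDensity S y)
    (hyb : ∀ᵐ s ∂(volume.restrict S), m₁ ≤ y s ∧ y s ≤ M₁) :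
    klDist S y (integralOp Ω a x) =
        ENNReal.ofReal (∫ s in S, y s * Real.log (y s / integralOp Ω a x s)) ∧
      IntegrableOn (fun s => y s * Real.log (y s / integralOp Ω a x s) - y s +
        integralOp Ω a x s) S ∧
      ∫ s in S, (y s * Real.log (y s / integralOp Ω a x s) - y s + integralOp Ω a x s) =
        ∫ s in S, y s * Real.log (y s / integralOp Ω a x s) := by
  have hi := K.integrable_mul_log_div hM hm₁ hx hy.integrable hyb hy.integrable
  have hiA := K.integrable_integralOp hx.integrable
  have hint : IntegrableOn (fun s => y s * Real.log (y s / integralOp Ω a x s) - y s +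
      integralOp Ω a x s) S := (hi.sub hy.integrable).add hiA
  have heq : ∫ s in S, (y s * Real.log (y s / integralOp Ω a x s) - y s + integralOp Ω a x s) =
      ∫ s in S, y s * Real.log (y s / integralOp Ω a x s) := by
    have hi' : IntegrableOn (fun s => y s * Real.log (y s / integralOp Ω a x s) - y s) S :=
      hi.sub hy.integrable
    rw [integral_add hi' hiA, integral_sub hi hy.integrable, hy.mass,
      K.integral_integralOp hx.integrable, hx.mass]
    ring
  refine ⟨?_, hint, heq⟩
  rw [← heq, ofReal_integral_eq_lintegral_ofReal hint]
  · refine lintegral_congr_ae ?_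
    filter_upwards [K.integralOp_bounds hx] with s hA
    exact if_neg fun h => (K.pos.trans_le hA.1).ne' h.1
  · filter_upwards [hyb, K.integralOp_bounds hx] with s hys hA
    exact kl_nonneg (K.pos.trans_le hA.1) (hm₁.trans_le hys.1)

theorem integral_mul_log_div_le_gammaConst [IsFiniteMeasure (volume.restrict S)]
    (K : IsStochasticKernel Ω S a m M) (hM : 0 < M) {m₁ M₁ : ℝ} (hm₁ : 0 < m₁)
    {x y : EuclideanSpace ℝ (Fin d) → ℝ} (hx : IsDensity Ω x) (hy : IsDensity S y)
    (hyb : ∀ᵐ s ∂(volume.restrict S), m₁ ≤ y s ∧ y s ≤ M₁) :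
    ∫ s in S, y s * Real.log (y s / integralOp Ω a x s) ≤ gammaConst m M m₁ M₁ := by
  have h : ∫ s in S, y s * gammaConst m M m₁ M₁ = gammaConst m M m₁ M₁ := by
    rw [integral_mul_const, hy.mass, one_mul]
  rw [← h]
  refine integral_mono_ae (K.integrable_mul_log_div hM hm₁ hx hy.integrable hyb hy.integrable)
    (hy.integrable.mul_const _) ?_
  filter_upwards [hy.nonneg, K.abs_log_div_le hM hm₁ hx hyb] with s h1 h2
  exact mul_le_mul_of_nonneg_left ((le_abs_self _).trans h2) h1

theorem integrable_mul_log_emFactor [IsFiniteMeasure (volume.restrict Ω)]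
    [IsFiniteMeasure (volume.restrict S)] (K : IsStochasticKernel Ω S a m M) (hM : 0 < M)
    {x y z : EuclideanSpace ℝ (Fin d) → ℝ} (hx : IsDensity Ω x) (hy : IsDensity S y)
    (hz : IntegrableOn z Ω) :
    IntegrableOn (fun t => z t * Real.log (emFactor Ω S a y x t)) Ω := by
  refine hz.mul_bdd (c := max |Real.log (m / M)| |Real.log (M / m)|)
    (Real.measurable_log.comp_aemeasurable
      (K.aestronglyMeasurable_emFactor hx hy.integrable).aemeasurable).aestronglyMeasurable ?_
  filter_upwards [K.emFactor_bounds hM hx hy] with t ht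
  have h0 : 0 < m / M := div_pos K.pos hM
  exact abs_le_max_abs_abs (Real.log_le_log h0 ht.1) (Real.log_le_log (h0.trans_le ht.1) ht.2)

/-- The decrease of the Kullback-Leibler distance to a solution `z` of `A z = y` in an EM step with
data `yδ` is at least `d(yδ, A x) - γ δ`. -/
theorem sub_le_integral_mul_log_emFactor [IsFiniteMeasure (volume.restrict Ω)]
    [IsFiniteMeasure (volume.restrict S)] (K : IsStochasticKernel Ω S a m M) (hM : 0 < M)
    {m₁ M₁ δ : ℝ} (hm₁ : 0 < m₁) {x y yδ z : EuclideanSpace ℝ (Fin d) → ℝ} (hx : IsDensity Ω x)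
    (hy : IntegrableOn y S) (hyδ : IsDensity S yδ)
    (hyb : ∀ᵐ s ∂(volume.restrict S), m₁ ≤ yδ s ∧ yδ s ≤ M₁)
    (hδ : ∫ s in S, |y s - yδ s| ≤ δ) (hz : IsDensity Ω z)
    (hzy : integralOp Ω a z =ᵐ[volume.restrict S] y) :
    (∫ s in S, yδ s * Real.log (yδ s / integralOp Ω a x s)) - gammaConst m M m₁ M₁ * δ ≤
      ∫ t in Ω, z t * Real.log (emFactor Ω S a yδ x t) := by
  have hlog := K.integrable_log_div hM hm₁ hx hyδ.integrable hyb
  have hγ : 0 ≤ gammaConst m M m₁ M₁ := (abs_nonneg _).trans (le_max_left _ _)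
  have h1 : ∫ s in S, y s * Real.log (yδ s / integralOp Ω a x s) ≤
      ∫ t in Ω, z t * Real.log (emFactor Ω S a yδ x t) := by
    have h2 : ∫ s in S, y s * Real.log (yδ s / integralOp Ω a x s) =
        ∫ t in Ω, z t * ∫ s in S, a s t * Real.log (yδ s / integralOp Ω a x s) := by
      rw [← K.integral_mul_integralOp hlog hz.integrable]
      refine integral_congr_ae ?_
      filter_upwards [hzy] with s hs
      rw [hs, mul_comm]
    have h3 : IntegrableOn (fun t => z t *
        ∫ s in S, a s t * Real.log (yδ s / integralOp Ω a x s)) Ω := by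
      have h4 := (K.integrable_prod hlog hz.integrable).integral_prod_right
      refine h4.congr (ae_of_all _ fun t => ?_)
      simp only
      rw [← integral_const_mul]
      congr 1; ext s; ring
    rw [h2]
    refine integral_mono_ae h3 (K.integrable_mul_log_emFactor hM hx hyδ hz.integrable) ?_
    filter_upwards [hz.nonneg, K.integral_log_le_log_emFactor hM hx hyδ
      (hyb.mono fun s hs => hm₁.trans_le hs.1) hlog] with t h5 h6
    exact mul_le_mul_of_nonneg_left h6 h5
  refine le_trans ?_ h1
  rw [sub_le_iff_le_add, ← sub_le_iff_le_add', ← integral_sub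
    (K.integrable_mul_log_div hM hm₁ hx hyδ.integrable hyb hyδ.integrable)
    (K.integrable_mul_log_div hM hm₁ hx hyδ.integrable hyb hy)]
  calc _ ≤ ∫ s in S, gammaConst m M m₁ M₁ * |y s - yδ s| := by
        refine integral_mono_ae
          ((K.integrable_mul_log_div hM hm₁ hx hyδ.integrable hyb hyδ.integrable).sub
          (K.integrable_mul_log_div hM hm₁ hx hyδ.integrable hyb hy))
          ((hy.sub hyδ.integrable).abs.const_mul _) ?_
        filter_upwards [K.abs_log_div_le hM hm₁ hx hyb] with s hs
        rw [← sub_mul]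
        calc _ ≤ |(yδ s - y s) * Real.log (yδ s / integralOp Ω a x s)| := le_abs_self _
          _ = |Real.log (yδ s / integralOp Ω a x s)| * |y s - yδ s| := by
            rw [abs_mul, mul_comm, abs_sub_comm]
          _ ≤ _ := by gcongr
    _ = gammaConst m M m₁ M₁ * ∫ s in S, |y s - yδ s| := integral_const_mul _ _
    _ ≤ _ := by gcongr

end IsStochasticKernel

/-- If `x₀ P` is again a probability density, then `∫ z ln P ≤ d(z, x₀)`: the Kullback-Leibler
distance of `z` to `x₀ P` is nonnegative. -/
theorem integral_mul_log_le_klDist {z x₀ P : EuclideanSpace ℝ (Fin d) → ℝ}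
    (hz : IsDensity Ω z) (hx₀ : IsDensity Ω x₀) (hxP : IsDensity Ω fun t => x₀ t * P t)
    (hP : ∀ᵐ t ∂(volume.restrict Ω), 0 < P t)
    (hi : IntegrableOn (fun t => z t * Real.log (P t)) Ω) (hkl : klDist Ω z x₀ < ∞) :
    ∫ t in Ω, z t * Real.log (P t) ≤ (klDist Ω z x₀).toReal := by
  have hmeas : AEMeasurable (fun t => klIntegrand (z t) (x₀ t)) (volume.restrict Ω) :=
    measurable_klIntegrand.comp_aemeasurable
      (hz.integrable.aestronglyMeasurable.aemeasurable.prodMk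
        hx₀.integrable.aestronglyMeasurable.aemeasurable)
  have hfin := ae_lt_top' hmeas hkl.ne
  have h1 : ∫ t in Ω, z t * Real.log (P t) =
      ∫ t in Ω, (z t * Real.log (P t) + x₀ t - x₀ t * P t) := by
    have hi' : IntegrableOn (fun t => z t * Real.log (P t) + x₀ t) Ω := hi.add hx₀.integrable
    rw [integral_sub hi' hxP.integrable, integral_add hi hx₀.integrable,
      hx₀.mass, hxP.mass]
    ring
  rw [h1, klDist, ← integral_toReal hmeas hfin]
  refine integral_mono_ae ((hi.add hx₀.integrable).sub hxP.integrable)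
    (integrable_toReal_of_lintegral_ne_top hmeas hkl.ne) ?_
  filter_upwards [hx₀.nonneg, hz.nonneg, hP, hfin] with t h1 h2 h3 h4
  exact mul_log_le_klIntegrand h1 h2 h3 h4.ne

/-- Finite Kullback-Leibler distance forces absolute continuity, by the convention
`v ln (v / 0) = ∞` for `v ≠ 0`. -/
theorem ae_eq_zero_of_klDist_lt_top {z x₀ : EuclideanSpace ℝ (Fin d) → ℝ}
    (hz : IsDensity Ω z) (hx₀ : IsDensity Ω x₀) (hkl : klDist Ω z x₀ < ∞) :
    ∀ᵐ t ∂(volume.restrict Ω), x₀ t = 0 → z t = 0 := by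
  have hmeas : AEMeasurable (fun t => klIntegrand (z t) (x₀ t)) (volume.restrict Ω) :=
    measurable_klIntegrand.comp_aemeasurable
      (hz.integrable.aestronglyMeasurable.aemeasurable.prodMk
        hx₀.integrable.aestronglyMeasurable.aemeasurable)
  filter_upwards [ae_lt_top' hmeas hkl.ne] with t ht h0
  by_contra hne
  exact ht.ne (if_pos ⟨h0, hne⟩)

end Kernel

/-! ### Descent along the loping iteration -/

section Iteration

variable {d N : ℕ} {Ω : Set (EuclideanSpace ℝ (Fin d))}
  {S : Fin N → Set (EuclideanSpace ℝ (Fin d))}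
  {a : Fin N → EuclideanSpace ℝ (Fin d) → EuclideanSpace ℝ (Fin d) → ℝ}
  {m M m₁ M₁ τ γ : ℝ} {x₀ z : EuclideanSpace ℝ (Fin d) → ℝ}
  {y yδ : Fin N → EuclideanSpace ℝ (Fin d) → ℝ} {δ : Fin N → ℝ}

/-- The standing assumptions: stochastic kernels, a starting density `x₀`, and a density `z` at
finite Kullback-Leibler distance from `x₀` that solves `A_j z = y_j` for all `j`. -/
structure IsConsistentSystem (Ω : Set (EuclideanSpace ℝ (Fin d)))
    (S : Fin N → Set (EuclideanSpace ℝ (Fin d)))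
    (a : Fin N → EuclideanSpace ℝ (Fin d) → EuclideanSpace ℝ (Fin d) → ℝ) (m M : ℝ)
    (x₀ z : EuclideanSpace ℝ (Fin d) → ℝ) (y : Fin N → EuclideanSpace ℝ (Fin d) → ℝ) :
    Prop where
  kernel : ∀ j, IsStochasticKernel Ω (S j) (a j) m M
  upper_pos : 0 < M
  start : IsDensity Ω x₀
  solution : IsDensity Ω z
  integrable : ∀ j, IntegrableOn (y j) (S j)
  eq : ∀ j, integralOp Ω (a j) z =ᵐ[volume.restrict (S j)] y j
  klDist_lt_top : klDist Ω z x₀ < ∞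

theorem IsNoisyData.isDensity (hD : IsNoisyData S m₁ M₁ y δ yδ) (hm₁ : 0 < m₁) (j : Fin N) :
    IsDensity (S j) (yδ j) :=
  ⟨hD.integrable j, (hD.bounds j).mono fun _ h => hm₁.le.trans h.1, hD.mass j⟩

theorem integrable_mul_log_of_bounds {P w : EuclideanSpace ℝ (Fin d) → ℝ} {c : ℝ} (hc : 0 < c)
    (hPm : AEStronglyMeasurable P (volume.restrict Ω))
    (hP : ∀ᵐ t ∂(volume.restrict Ω), c ≤ P t ∧ P t ≤ c⁻¹) (hw : IntegrableOn w Ω) :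
    IntegrableOn (fun t => w t * Real.log (P t)) Ω := by
  refine hw.mul_bdd (c := max |Real.log c| |Real.log c⁻¹|)
    (Real.measurable_log.comp_aemeasurable hPm.aemeasurable).aestronglyMeasurable ?_
  filter_upwards [hP] with t ht
  exact abs_le_max_abs_abs (Real.log_le_log hc ht.1) (Real.log_le_log (hc.trans_le ht.1) ht.2)

variable [NeZero N]

/-- Step `k` of the loping iteration is performed, that is, not skipped. -/
def IsActive (Ω : Set (EuclideanSpace ℝ (Fin d))) (S : Fin N → Set (EuclideanSpace ℝ (Fin d)))
    (a : Fin N → EuclideanSpace ℝ (Fin d) → EuclideanSpace ℝ (Fin d) → ℝ)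
    (τ γ : ℝ) (x₀ : EuclideanSpace ℝ (Fin d) → ℝ) (δ : Fin N → ℝ)
    (yδ : Fin N → EuclideanSpace ℝ (Fin d) → ℝ) (k : ℕ) : Prop :=
  ENNReal.ofReal (τ * γ * δ (Fin.ofNat N k)) <
    klDist (S (Fin.ofNat N k)) (yδ (Fin.ofNat N k))
      (integralOp Ω (a (Fin.ofNat N k)) (lopingIter Ω S a τ γ x₀ δ yδ k))

theorem lopingIter_succ_of_isActive {k : ℕ} (h : IsActive Ω S a τ γ x₀ δ yδ k) :
    lopingIter Ω S a τ γ x₀ δ yδ (k + 1) = fun t => lopingIter Ω S a τ γ x₀ δ yδ k t *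
      emFactor Ω (S (Fin.ofNat N k)) (a (Fin.ofNat N k)) (yδ (Fin.ofNat N k))
        (lopingIter Ω S a τ γ x₀ δ yδ k) t := by
  rw [lopingIter]
  exact if_pos h

theorem lopingIter_succ_of_not_isActive {k : ℕ} (h : ¬ IsActive Ω S a τ γ x₀ δ yδ k) :
    lopingIter Ω S a τ γ x₀ δ yδ (k + 1) = lopingIter Ω S a τ γ x₀ δ yδ k := by
  rw [lopingIter]
  exact if_neg h

theorem gammaConst_nonneg : 0 ≤ gammaConst m M m₁ M₁ :=
  (abs_nonneg _).trans (le_max_left _ _)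

variable [IsFiniteMeasure (volume.restrict Ω)] [∀ j, IsFiniteMeasure (volume.restrict (S j))]

theorem isDensity_lopingIter (H : IsConsistentSystem Ω S a m M x₀ z y) (hm₁ : 0 < m₁)
    (hD : IsNoisyData S m₁ M₁ y δ yδ) (k : ℕ) :
    IsDensity Ω (lopingIter Ω S a τ γ x₀ δ yδ k) := by
  induction k with
  | zero => exact H.start
  | succ k ih =>
    by_cases h : IsActive Ω S a τ γ x₀ δ yδ k
    · rw [lopingIter_succ_of_isActive h]
      exact (H.kernel _).isDensity_mul_emFactor H.upper_pos ih (hD.isDensity hm₁ _)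
    · rwa [lopingIter_succ_of_not_isActive h]

/-- A performed step decreases the Kullback-Leibler distance to the solution by more than
`(τ - 1) γ δ_j`.  As `d(yδ_j, A_j x) ≤ γ`, no step is performed if `γ = 0`. -/
theorem gain_of_isActive (H : IsConsistentSystem Ω S a m M x₀ z y) (hm₁ : 0 < m₁) (hτ : 1 < τ)
    (hγ : γ = gammaConst m M m₁ M₁) (hD : IsNoisyData S m₁ M₁ y δ yδ) {k : ℕ}
    (h : IsActive Ω S a τ γ x₀ δ yδ k) :
    0 < γ ∧ (τ - 1) * γ * δ (Fin.ofNat N k) < ∫ t in Ω, z t *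
      Real.log (emFactor Ω (S (Fin.ofNat N k)) (a (Fin.ofNat N k)) (yδ (Fin.ofNat N k))
        (lopingIter Ω S a τ γ x₀ δ yδ k) t) := by
  have hγ0 : 0 ≤ γ := hγ ▸ gammaConst_nonneg
  have hx : IsDensity Ω (lopingIter Ω S a τ γ x₀ δ yδ k) := isDensity_lopingIter H hm₁ hD k
  unfold IsActive at h
  generalize Fin.ofNat N k = j at h ⊢
  have hy := hD.isDensity hm₁ j
  have K := H.kernel j
  have hM := H.upper_pos
  have hδ := hD.pos j
  have hτγ : 0 ≤ τ * γ * δ j := by positivity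
  rw [(K.klDist_integralOp hM hm₁ hx hy (hD.bounds j)).1,
    ENNReal.ofReal_lt_ofReal_iff_of_nonneg hτγ] at h
  have h1 := K.integral_mul_log_div_le_gammaConst hM hm₁ hx hy (hD.bounds j)
  have h2 := K.sub_le_integral_mul_log_emFactor hM hm₁ hx (H.integrable j) hy (hD.bounds j)
    (hD.noise j) H.solution (H.eq j)
  rw [← hγ] at h1 h2
  refine ⟨?_, ?_⟩
  · linarith
  · linarith

open Classical in
/-- The `k`-th iterate is `x₀ P` with the product `P` of the factors of the performed steps, and
`∫ z ln P`, the total decrease of the Kullback-Leibler distance to `z`, grows at least linearly in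
the number of performed steps. -/
theorem exists_eq_mul_of_lopingIter (H : IsConsistentSystem Ω S a m M x₀ z y) (hm₁ : 0 < m₁)
    (hτ : 1 < τ) (hγ : γ = gammaConst m M m₁ M₁) (hD : IsNoisyData S m₁ M₁ y δ yδ) {δ₀ : ℝ}
    (hδ₀ : ∀ j, δ₀ ≤ δ j) (k : ℕ) :
    ∃ (P : EuclideanSpace ℝ (Fin d) → ℝ) (c : ℝ), 0 < c ∧
      AEStronglyMeasurable P (volume.restrict Ω) ∧
      (∀ᵐ t ∂(volume.restrict Ω), c ≤ P t ∧ P t ≤ c⁻¹) ∧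
      (lopingIter Ω S a τ γ x₀ δ yδ k = fun t => x₀ t * P t) ∧
      Nat.count (IsActive Ω S a τ γ x₀ δ yδ) k * ((τ - 1) * γ * δ₀) ≤
        ∫ t in Ω, z t * Real.log (P t) := by
  have hγ0 : 0 ≤ γ := hγ ▸ gammaConst_nonneg
  induction k with
  | zero =>
    refine ⟨fun _ => 1, 1, one_pos, aestronglyMeasurable_const, ae_of_all _ fun _ => by simp, ?_,
      by simp⟩
    ext t
    simp [lopingIter]
  | succ k ih =>
    obtain ⟨P, c, hc, hPm, hP, hxP, hcount⟩ := ih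
    by_cases h : IsActive Ω S a τ γ x₀ δ yδ k
    · have hx : IsDensity Ω (lopingIter Ω S a τ γ x₀ δ yδ k) := isDensity_lopingIter H hm₁ hD k
      have hgain := (gain_of_isActive H hm₁ hτ hγ hD h).2
      rw [lopingIter_succ_of_isActive h, Nat.count_succ, if_pos h]
      have hδj := hδ₀ (Fin.ofNat N k)
      generalize Fin.ofNat N k = j at hgain hδj ⊢
      have K := H.kernel j
      have hM := H.upper_pos
      have hy := hD.isDensity hm₁ j
      have hmM : 0 < m / M := div_pos K.pos hM
      set f := emFactor Ω (S j) (a j) (yδ j) (lopingIter Ω S a τ γ x₀ δ yδ k) with hf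
      have hfb := K.emFactor_bounds hM hx hy
      have hfm := K.aestronglyMeasurable_emFactor hx hy.integrable
      refine ⟨fun t => P t * f t, c * (m / M), by positivity, hPm.mul hfm, ?_, ?_, ?_⟩
      · filter_upwards [hP, hfb] with t h1 h2
        refine ⟨mul_le_mul h1.1 h2.1 hmM.le (hc.le.trans h1.1), ?_⟩
        rw [mul_inv, inv_div]
        exact mul_le_mul h1.2 h2.2 (hmM.le.trans h2.1) (inv_nonneg.2 hc.le)
      · rw [hxP]
        ext t
        ring
      · have hlog : ∫ t in Ω, z t * Real.log (P t * f t) =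
            (∫ t in Ω, z t * Real.log (P t)) + ∫ t in Ω, z t * Real.log (f t) := by
          rw [← integral_add (integrable_mul_log_of_bounds hc hPm hP H.solution.integrable)
            (K.integrable_mul_log_emFactor hM hx hy H.solution.integrable)]
          refine integral_congr_ae ?_
          filter_upwards [hP, hfb] with t h1 h2
          rw [Real.log_mul (hc.trans_le h1.1).ne' (hmM.trans_le h2.1).ne', mul_add]
        rw [hlog]
        push_cast
        rw [add_mul, one_mul]
        refine add_le_add hcount (le_trans ?_ hgain.le)
        have : 0 ≤ (τ - 1) * γ := mul_nonneg (by linarith) hγ0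
        gcongr
    · rw [lopingIter_succ_of_not_isActive h, Nat.count_succ, if_neg h, add_zero]
      exact ⟨P, c, hc, hPm, hP, hxP, hcount⟩

open Classical in
/-- The number of performed steps is `O(1 / δ_min)`. -/
theorem count_isActive_mul_le (H : IsConsistentSystem Ω S a m M x₀ z y) (hm₁ : 0 < m₁)
    (hτ : 1 < τ) (hγ : γ = gammaConst m M m₁ M₁) (hD : IsNoisyData S m₁ M₁ y δ yδ) {δ₀ : ℝ}
    (hδ₀ : ∀ j, δ₀ ≤ δ j) (k : ℕ) :
    Nat.count (IsActive Ω S a τ γ x₀ δ yδ) k * ((τ - 1) * γ * δ₀) ≤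
      (klDist Ω z x₀).toReal := by
  obtain ⟨P, c, hc, hPm, hP, hxP, hcount⟩ := exists_eq_mul_of_lopingIter H hm₁ hτ hγ hD hδ₀ k
  refine hcount.trans (integral_mul_log_le_klDist H.solution H.start ?_
    (hP.mono fun t h => hc.trans_le h.1)
    (integrable_mul_log_of_bounds hc hPm hP H.solution.integrable) H.klDist_lt_top)
  rw [← hxP]
  exact isDensity_lopingIter H hm₁ hD k

/-- A performed step changes the iterate: otherwise its factor would be one wherever the solution
does not vanish, and the step would have no gain. -/
theorem not_isActive_of_ae_eq (H : IsConsistentSystem Ω S a m M x₀ z y) (hm₁ : 0 < m₁)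
    (hτ : 1 < τ) (hγ : γ = gammaConst m M m₁ M₁) (hD : IsNoisyData S m₁ M₁ y δ yδ) {k : ℕ}
    (h : lopingIter Ω S a τ γ x₀ δ yδ (k + 1) =ᵐ[volume.restrict Ω]
      lopingIter Ω S a τ γ x₀ δ yδ k) : ¬ IsActive Ω S a τ γ x₀ δ yδ k := by
  intro hk
  have hgain := (gain_of_isActive H hm₁ hτ hγ hD hk).2
  have hδ := hD.pos (Fin.ofNat N k)
  have hγ0 : 0 ≤ γ := hγ ▸ gammaConst_nonneg
  obtain ⟨P, c, hc, -, hP, hxP, -⟩ := exists_eq_mul_of_lopingIter H hm₁ hτ hγ hD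
    (δ₀ := 0) (fun j => (hD.pos j).le) k
  rw [lopingIter_succ_of_isActive hk] at h
  have h0 : ∫ t in Ω, z t * Real.log (emFactor Ω (S (Fin.ofNat N k)) (a (Fin.ofNat N k))
      (yδ (Fin.ofNat N k)) (lopingIter Ω S a τ γ x₀ δ yδ k) t) = 0 := by
    refine integral_eq_zero_of_ae ?_
    filter_upwards [h, hP, ae_eq_zero_of_klDist_lt_top H.solution H.start H.klDist_lt_top]
      with t h1 h2 h3
    by_cases hx : x₀ t = 0
    · simp [h3 hx]
    · have hxk : lopingIter Ω S a τ γ x₀ δ yδ k t ≠ 0 := by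
        rw [hxP]
        exact mul_ne_zero hx (hc.trans_le h2.1).ne'
      have h4 := (mul_eq_left₀ hxk).1 h1
      rw [h4, Real.log_one, mul_zero]
      rfl
  rw [h0] at hgain
  have : 0 ≤ (τ - 1) * γ * δ (Fin.ofNat N k) :=
    mul_nonneg (mul_nonneg (by linarith) hγ0) hδ.le
  linarith

end Iteration

/-! ### The stopping index -/

section Stopping

variable {d N : ℕ} [NeZero N] {Ω : Set (EuclideanSpace ℝ (Fin d))}
  {S : Fin N → Set (EuclideanSpace ℝ (Fin d))}
  {a : Fin N → EuclideanSpace ℝ (Fin d) → EuclideanSpace ℝ (Fin d) → ℝ}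
  {m M m₁ M₁ τ γ : ℝ} {x₀ z : EuclideanSpace ℝ (Fin d) → ℝ}
  {y yδ : Fin N → EuclideanSpace ℝ (Fin d) → ℝ} {δ : Fin N → ℝ}

/-- A cycle at whose beginning the iteration does not stop contains a performed step. -/
theorem exists_isActive_of_notMem_stopSet {r : ℕ}
    (h : r * N ∉ stopSet N Ω (lopingIter Ω S a τ γ x₀ δ yδ)) :
    ∃ i < N, IsActive Ω S a τ γ x₀ δ yδ (r * N + i) := by
  by_contra! hna
  refine h ⟨dvd_mul_left N r, fun i hi => ?_⟩
  suffices lopingIter Ω S a τ γ x₀ δ yδ (r * N + i) =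
      lopingIter Ω S a τ γ x₀ δ yδ (r * N) by rw [this]
  induction i with
  | zero => rfl
  | succ i ih =>
    rw [← add_assoc, lopingIter_succ_of_not_isActive (hna i hi), ih (by omega)]

open Classical in
theorem le_count_isActive {r : ℕ}
    (h : ∀ i < r, i * N ∉ stopSet N Ω (lopingIter Ω S a τ γ x₀ δ yδ)) :
    r ≤ Nat.count (IsActive Ω S a τ γ x₀ δ yδ) (r * N) := by
  induction r with
  | zero => simp
  | succ r ih =>
    have h1 := ih fun i hi => h i (by omega)
    obtain ⟨i, hi, hact⟩ := exists_isActive_of_notMem_stopSet (h r (by omega))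
    have h2 : Nat.count (IsActive Ω S a τ γ x₀ δ yδ) (r * N) <
        Nat.count (IsActive Ω S a τ γ x₀ δ yδ) ((r + 1) * N) := by
      refine lt_of_le_of_lt (Nat.count_monotone _ (Nat.le_add_right _ i))
        (Nat.count_strict_mono hact ?_)
      rw [add_mul]; omega
    omega

variable [IsFiniteMeasure (volume.restrict Ω)] [∀ j, IsFiniteMeasure (volume.restrict (S j))]

/-- If none of the first `r > 0` cycles is a stopping cycle, then `r` is bounded by a constant times
the inverse of the noise level. -/
theorem mul_le_of_notMem_stopSet (H : IsConsistentSystem Ω S a m M x₀ z y) (hm₁ : 0 < m₁)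
    (hτ : 1 < τ) (hγ : γ = gammaConst m M m₁ M₁) (hD : IsNoisyData S m₁ M₁ y δ yδ) {δ₀ : ℝ}
    (hδ₀ : ∀ j, δ₀ ≤ δ j) (hδ₀' : 0 < δ₀) {r : ℕ} (hr : 0 < r)
    (h : ∀ i < r, i * N ∉ stopSet N Ω (lopingIter Ω S a τ γ x₀ δ yδ)) :
    0 < γ ∧ r * ((τ - 1) * γ * δ₀) ≤ (klDist Ω z x₀).toReal := by
  classical
  obtain ⟨i, -, hact⟩ := exists_isActive_of_notMem_stopSet (h 0 hr)
  have hγ0 := (gain_of_isActive H hm₁ hτ hγ hD hact).1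
  refine ⟨hγ0, le_trans ?_ (count_isActive_mul_le H hm₁ hτ hγ hD hδ₀ (r * N))⟩
  have h1 := le_count_isActive h
  have h2 : 0 < τ - 1 := by linarith
  gcongr

theorem stopSet_nonempty (H : IsConsistentSystem Ω S a m M x₀ z y) (hm₁ : 0 < m₁)
    (hτ : 1 < τ) (hγ : γ = gammaConst m M m₁ M₁) (hD : IsNoisyData S m₁ M₁ y δ yδ) :
    (stopSet N Ω (lopingIter Ω S a τ γ x₀ δ yδ)).Nonempty := by
  by_contra hne
  rw [Set.not_nonempty_iff_eq_empty] at hne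
  obtain ⟨j₀, -, hj₀⟩ := Finset.exists_min_image Finset.univ δ Finset.univ_nonempty
  have key : ∀ r : ℕ, 0 < r →
      0 < γ ∧ r * ((τ - 1) * γ * δ j₀) ≤ (klDist Ω z x₀).toReal := fun r hr =>
    mul_le_of_notMem_stopSet H hm₁ hτ hγ hD (fun j => hj₀ j (Finset.mem_univ j)) (hD.pos j₀) hr
      (fun i _ => by simp [hne])
  have hγ0 := (key 1 one_pos).1
  have hpos : 0 < (τ - 1) * γ * δ j₀ := mul_pos (mul_pos (by linarith) hγ0) (hD.pos j₀)
  obtain ⟨r, hr⟩ := exists_nat_gt ((klDist Ω z x₀).toReal / ((τ - 1) * γ * δ j₀))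
  have h1 := (key (r + 1) (by omega)).2
  rw [div_lt_iff₀ hpos] at hr
  push_cast at h1
  linarith [add_mul (r : ℝ) 1 ((τ - 1) * γ * δ j₀)]

/-- If the stopping index is positive, then `γ > 0`; for `γ = 0` the bound reads `0 ≤ 0`, with
division by zero. -/
theorem stopIndex_le (H : IsConsistentSystem Ω S a m M x₀ z y) (hm₁ : 0 < m₁)
    (hτ : 1 < τ) (hγ : γ = gammaConst m M m₁ M₁) (hD : IsNoisyData S m₁ M₁ y δ yδ) :
    (stopIndex Ω S a τ γ x₀ δ yδ : ℝ) ≤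
      N * (klDist Ω z x₀).toReal / ((τ - 1) * γ) /
        Finset.univ.inf' Finset.univ_nonempty δ := by
  have hγ0 : 0 ≤ γ := hγ ▸ gammaConst_nonneg
  have hτ1 : 0 < τ - 1 := by linarith
  set δ₀ := Finset.univ.inf' Finset.univ_nonempty δ with hδ₀def
  have hδ₀ : ∀ j, δ₀ ≤ δ j := fun j => Finset.inf'_le δ (Finset.mem_univ j)
  have hδ₀' : 0 < δ₀ := (Finset.lt_inf'_iff _).2 fun j _ => hD.pos j
  have hmem := Nat.sInf_mem (stopSet_nonempty (τ := τ) (a := a) H hm₁ hτ hγ hD)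
  obtain ⟨r, hr⟩ := hmem.1
  have hidx : stopIndex Ω S a τ γ x₀ δ yδ = r * N := by rw [stopIndex, hr, mul_comm]
  rcases Nat.eq_zero_or_pos r with h0 | hr0
  · rw [hidx, h0]
    simp only [zero_mul, Nat.cast_zero]
    positivity
  · obtain ⟨hγp, hle⟩ := mul_le_of_notMem_stopSet H hm₁ hτ hγ hD hδ₀ hδ₀' hr0 (by
      intro i hi
      refine Nat.notMem_of_lt_sInf ?_
      change i * N < stopIndex Ω S a τ γ x₀ δ yδ
      rw [hidx]
      exact Nat.mul_lt_mul_of_pos_right hi (NeZero.pos N))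
    rw [hidx, le_div_iff₀ hδ₀', le_div_iff₀ (mul_pos hτ1 hγp)]
    push_cast
    calc (r : ℝ) * N * δ₀ * ((τ - 1) * γ) = N * (r * ((τ - 1) * γ * δ₀)) := by ring
      _ ≤ _ := by gcongr

/-- At the stopping index all equations satisfy the discrepancy principle, since no step of the
following cycle is performed. -/
theorem klDist_stoppedIterate_le (H : IsConsistentSystem Ω S a m M x₀ z y) (hm₁ : 0 < m₁)
    (hτ : 1 < τ) (hγ : γ = gammaConst m M m₁ M₁) (hD : IsNoisyData S m₁ M₁ y δ yδ) (j : Fin N) :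
    klDist (S j) (yδ j) (integralOp Ω (a j) (stoppedIterate Ω S a τ γ x₀ δ yδ)) ≤
      ENNReal.ofReal (τ * γ * δ j) := by
  obtain ⟨⟨r, hr⟩, hfix⟩ := Nat.sInf_mem (stopSet_nonempty (τ := τ) (a := a) H hm₁ hτ hγ hD)
  change stopIndex Ω S a τ γ x₀ δ yδ = N * r at hr
  change ∀ i ≤ N, lopingIter Ω S a τ γ x₀ δ yδ (stopIndex Ω S a τ γ x₀ δ yδ + i)
    =ᵐ[volume.restrict Ω] stoppedIterate Ω S a τ γ x₀ δ yδ at hfix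
  set k := stopIndex Ω S a τ γ x₀ δ yδ with hk
  have h1 := hfix j j.2.le
  have h2 := hfix (j + 1) j.2
  have hna := not_isActive_of_ae_eq (k := k + j) H hm₁ hτ hγ hD (h2.trans h1.symm)
  have hj : Fin.ofNat N (k + j) = j := by
    ext
    simp [Fin.ofNat, hr, Nat.mod_eq_of_lt j.2]
  have hA : integralOp Ω (a j) (lopingIter Ω S a τ γ x₀ δ yδ (k + j)) =
      integralOp Ω (a j) (stoppedIterate Ω S a τ γ x₀ δ yδ) := by
    ext s
    refine integral_congr_ae ?_
    filter_upwards [h1] with t ht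
    rw [ht]
  rw [IsActive, hj, hA, not_lt] at hna
  exact hna

end Stopping

/-! ### Convergence of residuals and weak limits -/

section Convergence

/-- A bounded function that is small in `L¹` is small in `L^p`, since
`∫ |w|^p ≤ B^(p-1) ∫ |w|`. -/
theorem eLpNorm_lt_ofReal_of_integral_abs {α : Type*} [MeasurableSpace α] {μ : Measure α}
    {w : α → ℝ} {B e : ℝ} {p : ℝ≥0∞} (hp1 : 1 ≤ p) (hp : p ≠ ∞) (hw : Integrable w μ)
    (hB : ∀ᵐ x ∂μ, |w x| ≤ B) (he : 0 < e)
    (h : B ^ (p.toReal - 1) * ∫ x, |w x| ∂μ < e ^ p.toReal) :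
    eLpNorm w p μ < ENNReal.ofReal e := by
  have hP1 : 1 ≤ p.toReal := by
    rw [← ENNReal.toReal_one]; exact ENNReal.toReal_mono hp hp1
  have hp0 : p ≠ 0 := (one_pos.trans_le hp1).ne'
  set P := p.toReal with hP
  have hP0 : 0 < P := by linarith
  rw [eLpNorm_eq_lintegral_rpow_enorm_toReal hp0 hp, ← hP, one_div,
    ENNReal.rpow_inv_lt_iff hP0, ENNReal.ofReal_rpow_of_pos he]
  have hle : ∫⁻ x, ‖w x‖ₑ ^ P ∂μ ≤ ∫⁻ x, ENNReal.ofReal (B ^ (P - 1) * |w x|) ∂μ := by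
    refine lintegral_mono_ae ?_
    filter_upwards [hB] with x hx
    rw [Real.enorm_eq_ofReal_abs, ENNReal.ofReal_rpow_of_nonneg (abs_nonneg _) hP0.le]
    refine ENNReal.ofReal_le_ofReal ?_
    rcases eq_or_ne (w x) 0 with h0 | h0
    · simp [h0, Real.zero_rpow hP0.ne']
    calc |w x| ^ P = |w x| ^ (P - 1) * |w x| := by
          rw [Real.rpow_sub_one (abs_pos.2 h0).ne', div_mul_cancel₀ _ (abs_pos.2 h0).ne']
      _ ≤ _ := by
          gcongr
  refine hle.trans_lt ?_
  by_cases hB0 : 0 ≤ B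
  · rw [← ofReal_integral_eq_lintegral_ofReal (hw.abs.const_mul _) (ae_of_all _ fun x => by
      positivity), integral_const_mul]
    exact (ENNReal.ofReal_lt_ofReal_iff (Real.rpow_pos_of_pos he _)).2 h
  -- If `B < 0`, the measure is zero.
  · have h0 : ∫⁻ x, ENNReal.ofReal (B ^ (P - 1) * |w x|) ∂μ = 0 := by
      have : ∀ᵐ x ∂μ, False := by
        filter_upwards [hB] with x hx
        exact hB0 ((abs_nonneg _).trans hx)
      rw [lintegral_eq_zero_iff' (by fun_prop (disch := exact hw.aestronglyMeasurable.aemeasurable))]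
      exact this.mono fun _ h => h.elim
    rw [h0]
    exact ENNReal.ofReal_pos.2 (Real.rpow_pos_of_pos he _)

variable {d N : ℕ} [NeZero N] {Ω : Set (EuclideanSpace ℝ (Fin d))}
  {S : Fin N → Set (EuclideanSpace ℝ (Fin d))}
  {a : Fin N → EuclideanSpace ℝ (Fin d) → EuclideanSpace ℝ (Fin d) → ℝ}
  {m M m₁ M₁ τ γ : ℝ} {x₀ z : EuclideanSpace ℝ (Fin d) → ℝ}
  {y yδ : Fin N → EuclideanSpace ℝ (Fin d) → ℝ} {δ : Fin N → ℝ}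
  [IsFiniteMeasure (volume.restrict Ω)] [∀ j, IsFiniteMeasure (volume.restrict (S j))]

/-- The `L¹` residual at the stopping index: the discrepancy principle bounds the squared `L²`
distance of `A x` to the noisy data, and `|w| ≤ κ + w² / (4 κ)`. -/
theorem integral_abs_residual_le (H : IsConsistentSystem Ω S a m M x₀ z y) (hm₁ : 0 < m₁)
    (hτ : 1 < τ) (hγ : γ = gammaConst m M m₁ M₁) (hD : IsNoisyData S m₁ M₁ y δ yδ) (j : Fin N)
    {κ : ℝ} (hκ : 0 < κ) :
    ∫ s in S j, |integralOp Ω (a j) (stoppedIterate Ω S a τ γ x₀ δ yδ) s - y j s| ≤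
      κ * volume.real (S j) + (max M M₁ * τ * γ / κ + 1) * δ j := by
  have hγ0 : 0 ≤ γ := hγ ▸ gammaConst_nonneg
  have hx : IsDensity Ω (stoppedIterate Ω S a τ γ x₀ δ yδ) := isDensity_lopingIter H hm₁ hD _
  have hkl := klDist_stoppedIterate_le H hm₁ hτ hγ hD j
  have hy := hD.isDensity hm₁ j
  have K := H.kernel j
  have hM := H.upper_pos
  have hδ := hD.pos j
  obtain ⟨hkl1, hkli, hkl2⟩ := K.klDist_integralOp hM hm₁ hx hy (hD.bounds j)
  rw [hkl1, ← hkl2, ENNReal.ofReal_le_ofReal_iff (by positivity)] at hkl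
  set u := integralOp Ω (a j) (stoppedIterate Ω S a τ γ x₀ δ yδ) with hu
  have hui : IntegrableOn u (S j) := K.integrable_integralOp hx.integrable
  set C := max M M₁ with hC
  have hC0 : 0 < C := lt_max_of_lt_left hM
  have hbi : IntegrableOn (fun s => κ + C / κ *
      (yδ j s * Real.log (yδ j s / u s) - yδ j s + u s)) (S j) :=
    (integrable_const κ).add (hkli.const_mul _)
  have hni : IntegrableOn (fun s => |y j s - yδ j s|) (S j) :=
    ((H.integrable j).sub hy.integrable).abs
  calc ∫ s in S j, |u s - y j s|
      ≤ ∫ s in S j, ((κ + C / κ * (yδ j s * Real.log (yδ j s / u s) - yδ j s + u s)) +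
          |y j s - yδ j s|) := by
        refine integral_mono_ae (hui.sub (H.integrable j)).abs (hbi.add hni) ?_
        filter_upwards [K.integralOp_bounds hx, hD.bounds j] with s h1 h2
        have h3 := sq_sub_le_mul_kl (K := C) (K.pos.trans_le h1.1) (hm₁.trans_le h2.1)
          (h1.2.trans (le_max_left _ _)) (h2.2.trans (le_max_right _ _))
        have h4 : |yδ j s - u s| ≤
            κ + C / κ * (yδ j s * Real.log (yδ j s / u s) - yδ j s + u s) := by
          have h5 := sq_nonneg (|yδ j s - u s| - 2 * κ)
          rw [sub_sq, sq_abs] at h5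
          -- `h5` is `κ |w| ≤ κ² + w² / 4` with `w = yδ - u`, and `w² / 4` is bounded by `h3`.
          have h6 : κ * |yδ j s - u s| ≤ κ * (κ + C / κ *
              (yδ j s * Real.log (yδ j s / u s) - yδ j s + u s)) := by
            have h7 : κ * (κ + C / κ * (yδ j s * Real.log (yδ j s / u s) - yδ j s + u s)) =
                κ ^ 2 + C * (yδ j s * Real.log (yδ j s / u s) - yδ j s + u s) := by
              field_simp
            rw [h7]
            linarith
          exact le_of_mul_le_mul_left h6 hκ
        calc |u s - y j s| ≤ |u s - yδ j s| + |yδ j s - y j s| := abs_sub_le _ _ _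
          _ ≤ _ := by
            rw [abs_sub_comm (u s), abs_sub_comm _ (y j s)]
            exact add_le_add h4 le_rfl
    _ = κ * volume.real (S j) + C / κ *
          (∫ s in S j, (yδ j s * Real.log (yδ j s / u s) - yδ j s + u s)) +
          ∫ s in S j, |y j s - yδ j s| := by
        rw [integral_add hbi hni, integral_add (integrable_const κ) (hkli.const_mul _),
          integral_const_mul, integral_const, smul_eq_mul, measureReal_restrict_apply_univ,
          mul_comm (volume.real (S j))]
    _ ≤ κ * volume.real (S j) + C / κ * (τ * γ * δ j) + δ j := by
        gcongr
        exact hD.noise j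
    _ = _ := by ring

/-- The residuals of the exact equations at the stopping index tend to zero in `L^p`, uniformly over
the noisy data. -/
theorem exists_forall_eLpNorm_residual_lt (H : IsConsistentSystem Ω S a m M x₀ z y)
    (hm₁ : 0 < m₁) (hτ : 1 < τ) (hγ : γ = gammaConst m M m₁ M₁) {p : ℝ≥0∞} (hp1 : 1 ≤ p)
    (hp : p ≠ ∞) (j : Fin N) {ε : ℝ≥0∞} (hε : 0 < ε) :
    ∃ η : ℝ, 0 < η ∧ ∀ δ yδ, IsNoisyData S m₁ M₁ y δ yδ → (∀ i, δ i < η) →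
      eLpNorm (fun s => integralOp Ω (a j) (stoppedIterate Ω S a τ γ x₀ δ yδ) s - y j s)
        p (volume.restrict (S j)) < ε := by
  have hγ0 : 0 ≤ γ := hγ ▸ gammaConst_nonneg
  have hM := H.upper_pos
  have K := H.kernel j
  obtain ⟨e, he, heε⟩ : ∃ e : ℝ, 0 < e ∧ ENNReal.ofReal e ≤ ε := by
    have hmin : min ε 1 ≠ ∞ := (min_le_right ε 1).trans_lt ENNReal.one_lt_top |>.ne
    refine ⟨(min ε 1).toReal, ENNReal.toReal_pos (lt_min hε one_pos).ne' hmin, ?_⟩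
    rw [ENNReal.ofReal_toReal hmin]
    exact min_le_left _ _
  set V := volume.real (S j) with hV
  have hV0 : 0 ≤ V := measureReal_nonneg
  have hB : 0 < M ^ (p.toReal - 1) := Real.rpow_pos_of_pos hM _
  -- `|A x - y| ≤ M`, so `∫ |A x - y|^p ≤ M^(p-1) ∫ |A x - y|`, and an `L¹` norm below `θ` is enough.
  -- Half of `θ` is spent on the term `κ |S_j|`, the other half on the noise level.
  set θ := e ^ p.toReal / M ^ (p.toReal - 1) with hθ
  have hθ0 : 0 < θ := div_pos (Real.rpow_pos_of_pos he _) hB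
  set κ := θ / 2 / (V + 1) with hκ
  have hκ0 : 0 < κ := by positivity
  set C := max M M₁ * τ * γ / κ + 1 with hC
  have hC0 : 0 < C := by
    have : 0 < max M M₁ := lt_max_of_lt_left hM
    positivity
  refine ⟨θ / 2 / C, by positivity, fun δ yδ hD hδ => lt_of_lt_of_le ?_ heε⟩
  have hx : IsDensity Ω (stoppedIterate Ω S a τ γ x₀ δ yδ) := isDensity_lopingIter H hm₁ hD _
  refine eLpNorm_lt_ofReal_of_integral_abs (B := M) hp1 hp
    ((K.integrable_integralOp hx.integrable).sub (H.integrable j)) ?_ he ?_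
  · filter_upwards [K.integralOp_bounds hx, K.integralOp_bounds H.solution, H.eq j]
      with s h1 h2 h3
    rw [h3] at h2
    rw [abs_le]
    have := K.pos
    constructor <;> linarith [h1.1, h1.2, h2.1, h2.2]
  · have h1 := integral_abs_residual_le H hm₁ hτ hγ hD j hκ0
    rw [← hC, ← hV] at h1
    have h2 : κ * V ≤ θ / 2 := by
      rw [hκ, div_mul_eq_mul_div, div_le_iff₀ (by positivity)]
      nlinarith
    have h3 : C * δ j < θ / 2 := by
      have := hδ j
      rw [lt_div_iff₀ hC0] at this
      linarith [mul_comm C (δ j)]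
    have h4 : ∫ s in S j, |integralOp Ω (a j) (stoppedIterate Ω S a τ γ x₀ δ yδ) s - y j s| < θ :=
      by linarith
    rw [hθ, lt_div_iff₀ hB] at h4
    rw [mul_comm]
    exact h4

/-- Weak convergence in `L^p` can be tested with bounded functions, which lie in the dual `L^q` as
the measure is finite. -/
theorem WeaklyConvergesLp.tendsto_integral_mul {α : Type*} [MeasurableSpace α] {μ : Measure α}
    [IsFiniteMeasure μ] {p : ℝ≥0∞} [Fact (1 ≤ p)] {f : ℕ → α → ℝ} {z g : α → ℝ}
    (h : WeaklyConvergesLp μ p f z) (hg : AEStronglyMeasurable g μ) {C : ℝ}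
    (hgC : ∀ᵐ x ∂μ, ‖g x‖ ≤ C) :
    Tendsto (fun n => ∫ x, g x * f n x ∂μ) atTop (𝓝 (∫ x, g x * z x ∂μ)) := by
  obtain ⟨hf, hz, hF⟩ := h
  have hpq : p.HolderConjugate p.conjExponent := inferInstance
  have : (p.conjExponent).HolderConjugate p := ENNReal.HolderConjugate.symm
  have : Fact (1 ≤ p.conjExponent) := ⟨ENNReal.HolderConjugate.one_le p.conjExponent p⟩
  have hgq : MemLp g p.conjExponent μ := MemLp.of_bound hg C hgC
  have h1 := hF ((ContinuousLinearMap.mul ℝ ℝ).lpPairing μ p.conjExponent p (hgq.toLp g))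
  simpa only [pairing_toLp] using h1

/-- A weak limit `w` of the stopped iterates solves the exact system: as `a(s, ·)` is bounded,
`(A x)(s)` converges to `(A w)(s)` for a.e. `s`, while `A x` converges to the exact data in `L¹`. -/
theorem exists_weak_limit (H : IsConsistentSystem Ω S a m M x₀ z y) (hm₁ : 0 < m₁)
    (hτ : 1 < τ) (hγ : γ = gammaConst m M m₁ M₁) {δ : ℕ → Fin N → ℝ}
    {yδ : ℕ → Fin N → EuclideanSpace ℝ (Fin d) → ℝ}
    (hD : ∀ l, IsNoisyData S m₁ M₁ y (δ l) (yδ l))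
    (hδ : ∀ j, Tendsto (fun l => δ l j) atTop (𝓝 0)) {p : ℝ≥0∞} [Fact (1 ≤ p)] (h1p : 1 < p)
    (hp : p ≠ ∞) {B : ℝ≥0∞} (hB : B ≠ ∞)
    (hbd : ∀ l, eLpNorm (stoppedIterate Ω S a τ γ x₀ (δ l) (yδ l)) p (volume.restrict Ω) ≤ B) :
    ∃ (φ : ℕ → ℕ) (z : EuclideanSpace ℝ (Fin d) → ℝ), StrictMono φ ∧
      WeaklyConvergesLp (volume.restrict Ω) p
        (fun i => stoppedIterate Ω S a τ γ x₀ (δ (φ i)) (yδ (φ i))) z ∧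
      ∀ j, integralOp Ω (a j) z =ᵐ[volume.restrict (S j)] y j := by
  have hx : ∀ l, IsDensity Ω (stoppedIterate Ω S a τ γ x₀ (δ l) (yδ l)) := fun l =>
    isDensity_lopingIter H hm₁ (hD l) _
  obtain ⟨φ, w, hφ, hw, hweak⟩ := exists_subseq_weaklyConvergesLp h1p hp
    (fun l => ⟨(hx l).integrable.aestronglyMeasurable, (hbd l).trans_lt hB.lt_top⟩) hB hbd
  refine ⟨φ, w, hφ, hweak, fun j => ?_⟩
  have K := H.kernel j
  have hL1 : Tendsto (fun i => eLpNorm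
      (integralOp Ω (a j) (stoppedIterate Ω S a τ γ x₀ (δ (φ i)) (yδ (φ i))) - y j) 1
      (volume.restrict (S j))) atTop (𝓝 0) := by
    rw [ENNReal.tendsto_nhds_zero]
    intro ε hε
    obtain ⟨η, hη, hres⟩ := exists_forall_eLpNorm_residual_lt H hm₁ hτ hγ le_rfl
      ENNReal.one_ne_top j hε
    have hev : ∀ᶠ i in atTop, ∀ k, δ (φ i) k < η := by
      rw [eventually_all]
      exact fun k => ((hδ k).comp hφ.tendsto_atTop).eventually_lt_const hη
    exact hev.mono fun i hi => (hres _ _ (hD (φ i)) hi).le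
  obtain ⟨ψ, hψ, hae⟩ := (tendstoInMeasure_of_tendsto_eLpNorm one_ne_zero
    (fun i => (K.integrable_integralOp (hx (φ i)).integrable).aestronglyMeasurable)
    (H.integrable j).aestronglyMeasurable hL1).exists_seq_tendsto_ae
  filter_upwards [hae, K.bounds_left, K.meas_left] with s h1 h2 h3
  have h4 := hweak.tendsto_integral_mul h3
    (h2.mono fun t ht => IsStochasticKernel.abs_bound K.pos ht)
  exact tendsto_nhds_unique (h4.comp hψ.tendsto_atTop) h1

end Convergence

end LopingOSEM

/-! ### The convergence theorem -/

open LopingOSEM in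
theorem mainTheorem3 {d N : ℕ} (hd : 1 ≤ d) [NeZero N]
    -- the domains
    (Ω : Set (EuclideanSpace ℝ (Fin d))) (hΩo : IsOpen Ω) (hΩb : Bornology.IsBounded Ω)
    (S : Fin N → Set (EuclideanSpace ℝ (Fin d)))
    (hSm : ∀ j, MeasurableSet (S j)) (hSb : ∀ j, Bornology.IsBounded (S j))
    -- the kernels
    (a : Fin N → EuclideanSpace ℝ (Fin d) → EuclideanSpace ℝ (Fin d) → ℝ)
    (ha : ∀ j, AEStronglyMeasurable (fun q => a j q.1 q.2)
      ((volume.restrict (S j)).prod (volume.restrict Ω)))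
    (hA1 : ∀ j, ∀ᵐ t ∂(volume.restrict Ω), ∫ s in S j, a j s t = 1)
    (m M : ℝ) (hm : 0 < m) (hM : 0 < M)
    (hA2 : ∀ j, ∀ᵐ q ∂((volume.restrict (S j)).prod (volume.restrict Ω)),
      m ≤ a j q.1 q.2 ∧ a j q.1 q.2 ≤ M)
    -- the exact data
    (y : Fin N → EuclideanSpace ℝ (Fin d) → ℝ)
    (hy : ∀ j, IntegrableOn (y j) (S j))
    (hA3 : ∀ j, ∫ s in S j, y j s = 1)
    (hA3' : ∃ M' : ℝ, 0 < M' ∧ ∀ j, ∀ᵐ s ∂(volume.restrict (S j)), y j s ≤ M')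
    -- the starting element is a probability density
    (x₀ : EuclideanSpace ℝ (Fin d) → ℝ) (hx₀ : IntegrableOn x₀ Ω)
    (hx₀_nonneg : ∀ᵐ t ∂(volume.restrict Ω), 0 ≤ x₀ t)
    (hx₀_mass : ∫ t in Ω, x₀ t = 1)
    -- existence of a nonnegative nonzero solution at finite distance from the starting element
    (hA4 : ∃ x : EuclideanSpace ℝ (Fin d) → ℝ, IntegrableOn x Ω ∧
      (∀ᵐ t ∂(volume.restrict Ω), 0 ≤ x t) ∧
      (¬ x =ᵐ[volume.restrict Ω] 0) ∧
      (∀ j, integralOp Ω (a j) x =ᵐ[volume.restrict (S j)] y j) ∧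
      klDist Ω x x₀ < ∞)
    -- the constants of the method
    (m₁ M₁ τ γ : ℝ) (hm₁ : 0 < m₁) (hM₁ : 0 < M₁) (hτ : 1 < τ)
    (hγ : γ = gammaConst m M m₁ M₁) :
    -- (i) the stopping index is finite
    (∀ δ yδ, IsNoisyData S m₁ M₁ y δ yδ →
      (stopSet N Ω (lopingIter Ω S a τ γ x₀ δ yδ)).Nonempty) ∧
    -- (ii) it is `O(1 / δ_min)`
    (∃ C : ℝ, ∀ δ yδ, IsNoisyData S m₁ M₁ y δ yδ →
      (stopIndex Ω S a τ γ x₀ δ yδ : ℝ) ≤ C / Finset.univ.inf' Finset.univ_nonempty δ) ∧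
    -- (iii) discrepancy estimate at the stopping index
    (∀ δ yδ, IsNoisyData S m₁ M₁ y δ yδ → ∀ j,
      klDist (S j) (yδ j) (integralOp Ω (a j) (stoppedIterate Ω S a τ γ x₀ δ yδ)) ≤
        ENNReal.ofReal (τ * γ * δ j)) ∧
    -- (iv) the residuals tend to zero in every `L^p`, `1 ≤ p < ∞`, as `δ → 0`
    (∀ p : ℝ≥0∞, 1 ≤ p → p ≠ ∞ → ∀ j, ∀ ε : ℝ≥0∞, 0 < ε → ∃ η : ℝ, 0 < η ∧
      ∀ δ yδ, IsNoisyData S m₁ M₁ y δ yδ → (∀ i, δ i < η) →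
        eLpNorm
          (fun s => integralOp Ω (a j) (stoppedIterate Ω S a τ γ x₀ δ yδ) s - y j s)
          p (volume.restrict (S j)) < ε) ∧
    -- (v) weak subsequential convergence to a solution of the exact system
    (∀ (δ : ℕ → Fin N → ℝ) (yδ : ℕ → Fin N → EuclideanSpace ℝ (Fin d) → ℝ),
      (∀ l, IsNoisyData S m₁ M₁ y (δ l) (yδ l)) →
      (∀ j, Tendsto (fun l => δ l j) atTop (𝓝 0)) →
      ∀ (p : ℝ≥0∞) [Fact (1 ≤ p)], 1 < p → p ≠ ∞ →
      (∃ B : ℝ≥0∞, B ≠ ∞ ∧ ∀ l,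
        eLpNorm (stoppedIterate Ω S a τ γ x₀ (δ l) (yδ l)) p (volume.restrict Ω) ≤ B) →
      ∃ (φ : ℕ → ℕ) (z : EuclideanSpace ℝ (Fin d) → ℝ), StrictMono φ ∧
        WeaklyConvergesLp (volume.restrict Ω) p
          (fun i => stoppedIterate Ω S a τ γ x₀ (δ (φ i)) (yδ (φ i))) z ∧
        ∀ j, integralOp Ω (a j) z =ᵐ[volume.restrict (S j)] y j) := by
  subst hγ
  have hΩf : IsFiniteMeasure (volume.restrict Ω) :=
    isFiniteMeasure_restrict.2 hΩb.measure_lt_top.ne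
  have hSf : ∀ j, IsFiniteMeasure (volume.restrict (S j)) := fun j =>
    isFiniteMeasure_restrict.2 (hSb j).measure_lt_top.ne
  obtain ⟨z, hzi, hz0, -, hzy, hzkl⟩ := hA4
  have K : ∀ j, IsStochasticKernel Ω (S j) (a j) m M := fun j => ⟨hm, ha j, hA1 j, hA2 j⟩
  have hz : IsDensity Ω z := by
    refine ⟨hzi, hz0, ?_⟩
    rw [← (K 0).integral_integralOp hzi, integral_congr_ae (hzy 0), hA3 0]
  have H : IsConsistentSystem Ω S a m M x₀ z y :=
    ⟨K, hM, ⟨hx₀, hx₀_nonneg, hx₀_mass⟩, hz, hy, hzy, hzkl⟩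
  exact ⟨fun δ yδ hD => stopSet_nonempty H hm₁ hτ rfl hD,
    ⟨_, fun δ yδ hD => stopIndex_le H hm₁ hτ rfl hD⟩,
    fun δ yδ hD j => klDist_stoppedIterate_le H hm₁ hτ rfl hD j,
    fun p hp1 hp j ε hε => exists_forall_eLpNorm_residual_lt H hm₁ hτ rfl hp1 hp j hε,
    fun δ yδ hD hδ p _ h1p hp ⟨B, hB, hbd⟩ => exists_weak_limit H hm₁ hτ rfl hD hδ h1p hp hB hbd⟩
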